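/- **Setting.** Fix $a\in(-1,1)$ and the nonlinearity $\sigma_a(t)=t$ for $t\ge 0$, $\sigma_a(t)=at$ for $t<0$; at the kink put $\dot\sigma_a(0)=s$ for a fixed $s\in[a,1]$. A depth $L$ network $\theta=(W_1,b_1,\dots,W_L,b_L)$ with arbitrary widths $n_0=d_{in},n_1,\dots,n_{L-1},n_L=d_{out}$ has $\alpha_0(x)=x$, $\tilde\alpha_\ell(x)=W_\ell\alpha_{\ell-1}(x)+b_\ell$, $\alpha_\ell(x)=\sigma_a(\tilde\alpha_\ell(x))$ and network function $f_\theta(x)=\tilde\alpha_L(x)$; $\|\theta\|^2$ is the sum of the squares of all entries of the $W_\ell$ and $b_\ell$. Its neural tangent kernel is the $d_{out}\times d_{out}$ matrix $\Theta^{(L)}(x,y)=\sum_w \partial_w f_\theta(x)\,\partial_w f_\theta(y)^T$, the sum running over all entries $w$ of the weight matrices and the derivatives being computed by the chain rule with $\dot\sigma_a$, so that $\mathrm{Tr}\,\Theta^{(L)}(x,x)=\sum_{\ell=1}^L\|\alpha_{\ell-1}(x)\|^2\|J(\tilde\alpha_\ell\to f_\theta)(x)\|_F^2$. A finite piecewise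 linear function (FPLF) is a map that is affine on each of finitely many closed polyhedra covering its domain. The bottleneck rank $\mathrm{Rank}_{BN}(f;\Omega)$ is the smallest $k$ such that $f=h\circ g$ on $\Omega$ with FPLFs $g:\Omega\to\mathbb R^k$ and $h:\mathbb R^k\to\mathbb R^{d_{out}}$. **Theorem 6.** Let $\Omega\subset\mathbb R^{d_{in}}$, let $f^*:\Omega\to\mathbb R^{d_{out}}$ and let $k^*>1$. Suppose that there is $x_0\in\Omega$ near which $\Omega$ is a $d$-dimensional embedded $C^1$ submanifold (for example $d=d_{in}$ and $x_0$ an interior point of $\Omega$), such that $f^*$ is $C^1$ on $\Omega$ near $x_0$ and $\mathrm{Rank}\,Jf^*(x_0)_{|T_{x_0}\Omega}=k^*$. Let $\mu$ be a probability distribution with support $\Omega$ (that is, $\mu(\Omega)=1$ and every neighborhood of every point of $\Omega$ has positive mass) which near $x_0$ is absolutely continuous with respect to the $d$-dimensional Hausdorff measure. Then there are a constant $c''>0$ and depths $L_0(N,C)$, for $N\in\mathbb N$ and $C\in\mathbb R$, such that the following holds with probability tending to $1$ as $N\to\infty$ over training points $x_1,\dots,x_N$ sampled independently from $\mu$: for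 all $C\in\mathbb R$, all $L\ge L_0(N,C)$ and all parameters $\theta$ of a depth $L$ network (of any widths) with $\|\theta\|^2=L+c_1$, $c_1\le C$, such that $\mathrm{Rank}_{BN}(f_\theta;\Omega)=1$ and $f_\theta(x_i)=f^*(x_i)$ for $i=1,\dots,N$, there is a point $x\in\Omega$ with $$\mathrm{Tr}\left[\Theta^{(L)}(x,x)\right]\ \ge\ c''\,L\,e^{-c_1}\,N^{4-\frac{4}{k^*}} .$$ -/

import Mathlib

open MeasureTheory Filter Topology Set
open scoped Matrix

noncomputable section

/-- The homogeneous nonlinearity `σ_a` (`a = 0` is the ReLU). -/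
def sigmaA (a t : ℝ) : ℝ := if 0 ≤ t then t else a * t

/-- The derivative of `σ_a`, with the value `s` at the kink `0`. -/
def dSigmaA (a s t : ℝ) : ℝ := if 0 < t then 1 else if t < 0 then a else s

/-- Parameters `θ` of a fully connected network with layers `0, …, L`, of arbitrary widths.
`W ℓ`, `b ℓ` are the weight matrix and the bias vector from layer `ℓ` to layer `ℓ + 1`
(usually denoted `W_{ℓ+1}`, `b_{ℓ+1}`). Only the entries with index `ℓ < L` are parameters of the
network: nothing below depends on the others. -/
structure NetParams (L din dout : ℕ) where
  width : ℕ → ℕ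
  width_zero : width 0 = din
  width_last : width L = dout
  W : (ℓ : ℕ) → Matrix (Fin (width (ℓ + 1))) (Fin (width ℓ)) ℝ
  b : (ℓ : ℕ) → Fin (width (ℓ + 1)) → ℝ

namespace NetParams

variable {L din dout : ℕ}

/-- The squared parameter norm `‖θ‖²`. -/
def normSq (θ : NetParams L din dout) : ℝ :=
  ∑ ℓ ∈ Finset.range L, ((∑ i, ∑ j, θ.W ℓ i j ^ 2) + ∑ i, θ.b ℓ i ^ 2)

/-- The activations `α_ℓ(x)`. -/
def act (θ : NetParams L din dout) (a : ℝ) (x : EuclideanSpace ℝ (Fin din)) :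
    (ℓ : ℕ) → Fin (θ.width ℓ) → ℝ
  | 0 => fun i => x (Fin.cast θ.width_zero i)
  | ℓ + 1 => fun i => sigmaA a ((θ.W ℓ *ᵥ act θ a x ℓ + θ.b ℓ) i)

/-- The pre-activations `W_ℓ α_{ℓ-1}(x) + b_ℓ` of layer `ℓ ≥ 1` (and `x` for `ℓ = 0`). -/
def preact (θ : NetParams L din dout) (a : ℝ) (x : EuclideanSpace ℝ (Fin din)) :
    (ℓ : ℕ) → Fin (θ.width ℓ) → ℝ
  | 0 => fun i => x (Fin.cast θ.width_zero i)
  | ℓ + 1 => θ.W ℓ *ᵥ act θ a x ℓ + θ.b ℓ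

/-- The network function `f_θ`: the pre-activations of the last layer. -/
def out (θ : NetParams L din dout) (a : ℝ) (x : EuclideanSpace ℝ (Fin din)) :
    EuclideanSpace ℝ (Fin dout) :=
  WithLp.toLp 2 fun k => θ.preact a x L (Fin.cast θ.width_last.symm k)

/-- The derivative of the activations `α_ℓ(x)` with respect to the weights, in the direction `V`,
by the chain rule with `dSigmaA a s` as the derivative of the nonlinearity. -/
def dAct (θ : NetParams L din dout) (a s : ℝ)
    (V : (ℓ : ℕ) → Matrix (Fin (θ.width (ℓ + 1))) (Fin (θ.width ℓ)) ℝ)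
    (x : EuclideanSpace ℝ (Fin din)) : (ℓ : ℕ) → Fin (θ.width ℓ) → ℝ
  | 0 => 0
  | ℓ + 1 => fun i => dSigmaA a s (θ.preact a x (ℓ + 1) i) *
      (V ℓ *ᵥ θ.act a x ℓ + θ.W ℓ *ᵥ dAct θ a s V x ℓ) i

/-- The derivative of the pre-activations of layer `ℓ` with respect to the weights, in the
direction `V`. -/
def dPreact (θ : NetParams L din dout) (a s : ℝ)
    (V : (ℓ : ℕ) → Matrix (Fin (θ.width (ℓ + 1))) (Fin (θ.width ℓ)) ℝ)
    (x : EuclideanSpace ℝ (Fin din)) : (ℓ : ℕ) → Fin (θ.width ℓ) → ℝ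
  | 0 => 0
  | ℓ + 1 => V ℓ *ᵥ θ.act a x ℓ + θ.W ℓ *ᵥ θ.dAct a s V x ℓ

/-- The partial derivative of `f_θ(x)_k` with respect to the entry `(i, j)` of `W ℓ`. -/
def dOut (θ : NetParams L din dout) (a s : ℝ) (ℓ : ℕ) (i : Fin (θ.width (ℓ + 1)))
    (j : Fin (θ.width ℓ)) (x : EuclideanSpace ℝ (Fin din)) (k : Fin dout) : ℝ :=
  θ.dPreact a s (Pi.single ℓ (Matrix.single i j 1)) x L (Fin.cast θ.width_last.symm k)

/-- The neural tangent kernel `Θ^{(L)}(x, y)`, a `dout × dout` matrix: the sum over all connection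
weights `w` of `∂_w f_θ(x) ∂_w f_θ(y)ᵀ`. Its trace at `(x, x)` is
`∑_ℓ ‖α_{ℓ-1}(x)‖² ‖J(α̃_ℓ → f_θ)(x)‖_F²`. The (nonnegative) contribution of the bias vectors
to the trace is not included. -/
def ntk (θ : NetParams L din dout) (a s : ℝ) (x y : EuclideanSpace ℝ (Fin din)) :
    Matrix (Fin dout) (Fin dout) ℝ :=
  Matrix.of fun k k' => ∑ ℓ ∈ Finset.range L, ∑ i, ∑ j,
    θ.dOut a s ℓ i j x k * θ.dOut a s ℓ i j y k'

end NetParams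

/-- A polyhedron: a finite intersection of closed half-spaces. -/
def IsPolyhedron {m : ℕ} (P : Set (EuclideanSpace ℝ (Fin m))) : Prop :=
  ∃ S : Finset (EuclideanSpace ℝ (Fin m) × ℝ), P = {x | ∀ p ∈ S, inner ℝ p.1 x ≤ p.2}

/-- `f` is a finite piecewise linear function (FPLF) on `D`: finitely many polyhedra cover `D`, and
`f` is affine on the part of `D` in each of them. As the polyhedra are closed and finite in
number, such an `f` is continuous on `D`. -/
def IsFPLFOn {m n : ℕ} (D : Set (EuclideanSpace ℝ (Fin m)))
    (f : EuclideanSpace ℝ (Fin m) → EuclideanSpace ℝ (Fin n)) : Prop :=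
  ∃ (r : ℕ) (P : Fin r → Set (EuclideanSpace ℝ (Fin m)))
    (A : Fin r → (EuclideanSpace ℝ (Fin m) →ᵃ[ℝ] EuclideanSpace ℝ (Fin n))),
    (∀ i, IsPolyhedron (P i)) ∧ D ⊆ ⋃ i, P i ∧ ∀ i, ∀ x ∈ D ∩ P i, f x = A i x

/-- The Bottleneck rank `Rank_BN(f; Ω)`: the smallest `k` such that `f = h ∘ g` on `Ω` for FPLFs
`g : Ω → ℝ^k` and `h : ℝ^k → ℝ^dout`. -/
def bnRank {din dout : ℕ} (f : EuclideanSpace ℝ (Fin din) → EuclideanSpace ℝ (Fin dout))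
    (Ω : Set (EuclideanSpace ℝ (Fin din))) : ℕ :=
  sInf {k | ∃ (g : EuclideanSpace ℝ (Fin din) → EuclideanSpace ℝ (Fin k))
    (h : EuclideanSpace ℝ (Fin k) → EuclideanSpace ℝ (Fin dout)),
    IsFPLFOn Ω g ∧ IsFPLFOn univ h ∧ ∀ x ∈ Ω, f x = h (g x)}

/-- `Ω` is, near `x ∈ Ω`, an embedded `d`-dimensional `C¹` submanifold with local parametrization
`φ` at `x = φ 0`: `φ` is `C¹` near `0`, its derivative at `0` is injective (its range is the tangent
space `T_x Ω`), and `φ` maps the neighborhoods of `0` to the neighborhoods of `x` in `Ω`. For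
`d = din` and `φ z = x + z` this says that `x` is an interior point of `Ω`. -/
structure IsLocalParam {din d : ℕ} (Ω : Set (EuclideanSpace ℝ (Fin din)))
    (x : EuclideanSpace ℝ (Fin din))
    (φ : EuclideanSpace ℝ (Fin d) → EuclideanSpace ℝ (Fin din)) : Prop where
  map_zero : φ 0 = x
  contDiffAt : ContDiffAt ℝ 1 φ 0
  injective : Function.Injective (fderiv ℝ φ 0)
  map_nhds : Filter.map φ (𝓝 0) = 𝓝[Ω] x

/-- Near `x`, the set `Ω` is a `d`-dimensional `C¹` submanifold on which `f` is `C¹`, and the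
Jacobian of `f` at `x`, restricted to `T_x Ω`, has rank `k`. -/
def HasJacobianRankAt {din dout : ℕ} (d : ℕ)
    (f : EuclideanSpace ℝ (Fin din) → EuclideanSpace ℝ (Fin dout))
    (Ω : Set (EuclideanSpace ℝ (Fin din))) (x : EuclideanSpace ℝ (Fin din)) (k : ℕ) : Prop :=
  ∃ φ : EuclideanSpace ℝ (Fin d) → EuclideanSpace ℝ (Fin din),
    IsLocalParam Ω x φ ∧ ContDiffAt ℝ 1 (f ∘ φ) 0 ∧
      Module.finrank ℝ (LinearMap.range (fderiv ℝ (f ∘ φ) 0).toLinearMap) = k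

end

/-! Write `‖θ‖² = L + c`. By the arithmetic-geometric mean inequality the product of the Frobenius
norms of all weight matrices is at most `e^{c/2}`, independently of the depth. Take two inputs at
distance at most `D` whose outputs are at least `r` apart. In each layer, the squared Frobenius norm
minus the squared gain along this pair is nonnegative, and these defects sum to at most `c + 2 log
(D/r)`. For large `L` some layer of the second half therefore has a tiny defect, so that its matrix
is nearly of rank one, and all outputs are determined up to `r/8` by one scalar function `p` of the
input (`exists_layer_near_rank_one`, `exists_scalar_coordinate`).

Suppose now that `n` points have `r`-separated outputs. Then `p` separates them on a line, and a
curve of bounded speed from the smallest to the largest value of `p` has to pass all `n` values in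
unit time. At least half as many gaps between consecutive values as there are points take time at
most `4/n`; in crossing one, the output somewhere has speed above `nr/16`. On the other hand `p` is
Lipschitz in the activations of every layer `ℓ` of the first half, with constant the product `B_ℓ`
of the later norms. So the times with `‖α_ℓ‖ ≤ nr/(128 B_ℓ)` have `p` in a window of length `nr/64`,
which meets few gaps. Double counting (`exists_short_crossing`) gives a quickly crossed gap free of
such times for most of these layers. At the fast time each such layer has a large activation and a
large Jacobian to the output, and contributes at least a constant times `e^{-c} (nr)^4` to the trace
(`exists_le_trace_ntk`); the number of these layers is proportional to `L`.

It remains to find separated points. Near `x₀` the projection of `f` to the range of its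
differential has, on a set of positive mass, a distribution of bounded density in dimension `k`
(`exists_patch`). Balls of radius `r` then have mass `O(r^k)`, so for `r` of order `N^{-1/k}` a
greedy selection keeps a fixed fraction of the `N` samples, with exponentially small failure
probability (`measure_compl_separatedSamples_le`). With `n` of order `N`, `(nr)^4` is of order
`N^{4-4/k}`. -/

/-! ### Euclidean and Frobenius norms -/

/-- The Euclidean norm of a tuple of real numbers. -/
noncomputable def euclNorm {n : ℕ} (v : Fin n → ℝ) : ℝ := ‖(WithLp.toLp 2 v : EuclideanSpace ℝ (Fin n))‖

/-- The squared Frobenius norm of a matrix. -/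
def frobSq {m n : ℕ} (W : Matrix (Fin m) (Fin n) ℝ) : ℝ := ∑ i, ∑ j, W i j ^ 2

lemma euclNorm_nonneg {n : ℕ} (v : Fin n → ℝ) : 0 ≤ euclNorm v := norm_nonneg _

lemma frobSq_nonneg {m n : ℕ} (W : Matrix (Fin m) (Fin n) ℝ) : 0 ≤ frobSq W := by
  unfold frobSq; positivity

lemma euclNorm_sq {n : ℕ} (v : Fin n → ℝ) : euclNorm v ^ 2 = ∑ i, v i ^ 2 := by
  simp [euclNorm, EuclideanSpace.norm_sq_eq]

lemma euclNorm_le_iff {n m : ℕ} (v : Fin n → ℝ) (w : Fin m → ℝ) :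
    euclNorm v ≤ euclNorm w ↔ ∑ i, v i ^ 2 ≤ ∑ i, w i ^ 2 := by
  rw [← euclNorm_sq, ← euclNorm_sq]
  exact (pow_le_pow_iff_left₀ (euclNorm_nonneg _) (euclNorm_nonneg _) two_ne_zero).symm

lemma euclNorm_add_le {n : ℕ} (v w : Fin n → ℝ) : euclNorm (v + w) ≤ euclNorm v + euclNorm w := by
  simpa [euclNorm] using norm_add_le (WithLp.toLp 2 v : EuclideanSpace ℝ (Fin n)) (WithLp.toLp 2 w)

lemma euclNorm_smul {n : ℕ} (c : ℝ) (v : Fin n → ℝ) : euclNorm (c • v) = |c| * euclNorm v := by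
  simp [euclNorm, norm_smul]

lemma abs_dotProduct_le {n : ℕ} (v w : Fin n → ℝ) : |v ⬝ᵥ w| ≤ euclNorm v * euclNorm w := by
  refine abs_le_of_sq_le_sq ?_ (mul_nonneg (euclNorm_nonneg _) (euclNorm_nonneg _))
  rw [mul_pow, euclNorm_sq, euclNorm_sq]
  exact Finset.sum_mul_sq_le_sq_mul_sq _ _ _

lemma sq_euclNorm_mulVec_le {m n : ℕ} (W : Matrix (Fin m) (Fin n) ℝ) (v : Fin n → ℝ) :
    euclNorm (W *ᵥ v) ^ 2 ≤ frobSq W * euclNorm v ^ 2 := by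
  rw [euclNorm_sq, euclNorm_sq, frobSq, Finset.sum_mul]
  exact Finset.sum_le_sum fun i _ => Finset.sum_mul_sq_le_sq_mul_sq Finset.univ (W i) v

lemma euclNorm_mulVec_le {m n : ℕ} (W : Matrix (Fin m) (Fin n) ℝ) (v : Fin n → ℝ) :
    euclNorm (W *ᵥ v) ≤ √(frobSq W) * euclNorm v := by
  refine le_of_sq_le_sq ?_ (mul_nonneg (Real.sqrt_nonneg _) (euclNorm_nonneg _))
  rw [mul_pow, Real.sq_sqrt (frobSq_nonneg W)]
  exact sq_euclNorm_mulVec_le W v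

/-- If `W` nearly attains its Frobenius norm on a vector `z`, then `W` is close to having rank one:
the component of `W v` orthogonal to a unit vector `u` is controlled by the defect. -/
lemma sq_euclNorm_mulVec_sub_le {m n : ℕ} (W : Matrix (Fin m) (Fin n) ℝ) (u : Fin m → ℝ)
    (hu : euclNorm u = 1) (z v : Fin n → ℝ) :
    euclNorm z ^ 2 * euclNorm (W *ᵥ v - (u ⬝ᵥ W *ᵥ v) • u) ^ 2 ≤
      (frobSq W * euclNorm z ^ 2 - (u ⬝ᵥ W *ᵥ z) ^ 2) * euclNorm v ^ 2 := by
  set c : Fin n → ℝ := u ᵥ* W with hc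
  have hdot : ∀ y : Fin n → ℝ, u ⬝ᵥ W *ᵥ y = c ⬝ᵥ y := fun y => by
    rw [hc, Matrix.dotProduct_mulVec]
  set M : Matrix (Fin m) (Fin n) ℝ := W - Matrix.vecMulVec u c with hM
  have hMv : W *ᵥ v - (u ⬝ᵥ W *ᵥ v) • u = M *ᵥ v := by
    rw [hM, Matrix.sub_mulVec, Matrix.vecMulVec_mulVec, hdot]
    ext i; simp
  have hu2 : ∑ i, u i ^ 2 = 1 := by rw [← euclNorm_sq, hu, one_pow]
  -- Pythagoras in each column: `M` is `W` with the `u`-component of every column removed. The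
  -- defect on `z` dominates this norm because `(c ⬝ᵥ z)² ≤ ‖c‖² ‖z‖²`.
  have hfro : frobSq M = frobSq W - euclNorm c ^ 2 := by
    have hcj : ∀ j, ∑ i, u i * W i j = c j := fun j => rfl
    have h1 : frobSq M = ∑ j, ∑ i, (W i j - u i * c j) ^ 2 := by
      rw [frobSq, Finset.sum_comm]; rfl
    have h2 : frobSq W = ∑ j, ∑ i, W i j ^ 2 := by rw [frobSq, Finset.sum_comm]
    rw [h1, h2, euclNorm_sq, ← Finset.sum_sub_distrib]
    refine Finset.sum_congr rfl fun j _ => ?_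
    have : ∀ i, (W i j - u i * c j) ^ 2 =
        W i j ^ 2 - 2 * c j * (u i * W i j) + c j ^ 2 * u i ^ 2 := fun i => by ring
    simp_rw [this]
    rw [Finset.sum_add_distrib, Finset.sum_sub_distrib, ← Finset.mul_sum, ← Finset.mul_sum, hcj,
      hu2]
    ring
  have h3 := sq_euclNorm_mulVec_le M v
  have h4 : (c ⬝ᵥ z) ^ 2 ≤ euclNorm c ^ 2 * euclNorm z ^ 2 := by
    rw [← mul_pow, ← sq_abs]
    exact pow_le_pow_left₀ (abs_nonneg _) (abs_dotProduct_le c z) 2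
  rw [hMv, hdot]
  calc euclNorm z ^ 2 * euclNorm (M *ᵥ v) ^ 2
      ≤ euclNorm z ^ 2 * (frobSq M * euclNorm v ^ 2) := by gcongr
    _ = (frobSq W * euclNorm z ^ 2 - euclNorm c ^ 2 * euclNorm z ^ 2) * euclNorm v ^ 2 := by
        rw [hfro]; ring
    _ ≤ _ := by gcongr

/-! ### The nonlinearity -/

lemma abs_sigmaA_sub_le {a : ℝ} (ha : |a| ≤ 1) (t u : ℝ) :
    |sigmaA a t - sigmaA a u| ≤ |t - u| := by
  have key : ∀ t u : ℝ, 0 ≤ t → u < 0 → |t - a * u| ≤ |t - u| := fun t u ht hu => by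
    rw [abs_le] at ha
    rw [abs_of_nonneg (by linarith : 0 ≤ t - u), abs_le]
    constructor <;> nlinarith
  unfold sigmaA
  split_ifs with h1 h2 h2
  · exact le_rfl
  · exact key t u h1 (not_le.1 h2)
  · rw [abs_sub_comm, abs_sub_comm t u]; exact key u t h2 (not_le.1 h1)
  · rw [← mul_sub, abs_mul]; exact mul_le_of_le_one_left (abs_nonneg _) ha

lemma abs_dSigmaA_le {a s : ℝ} (ha : |a| ≤ 1) (hs : |s| ≤ 1) (t : ℝ) : |dSigmaA a s t| ≤ 1 := by
  unfold dSigmaA; split_ifs <;> simp [ha, hs]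

lemma continuous_sigmaA {a : ℝ} (ha : |a| ≤ 1) : Continuous (sigmaA a) := by
  refine (LipschitzWith.of_dist_le_mul (K := 1) fun t u => ?_).continuous
  simpa [Real.dist_eq] using abs_sigmaA_sub_le ha t u

/-! ### Lipschitz estimates for networks -/

namespace NetParams

variable {L din dout : ℕ} (θ : NetParams L din dout)

/-- The Frobenius norm of the weight matrix `W ℓ`. -/
noncomputable def fro (ℓ : ℕ) : ℝ := √(frobSq (θ.W ℓ))

lemma fro_nonneg (ℓ : ℕ) : 0 ≤ θ.fro ℓ := Real.sqrt_nonneg _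

lemma fro_sq (ℓ : ℕ) : θ.fro ℓ ^ 2 = frobSq (θ.W ℓ) := Real.sq_sqrt (frobSq_nonneg _)

/-- The product of the Frobenius norms of the weight matrices `W j`, `ℓ ≤ j < m`. -/
noncomputable def froProd (ℓ m : ℕ) : ℝ := ∏ j ∈ Finset.Ico ℓ m, θ.fro j

lemma froProd_nonneg (ℓ m : ℕ) : 0 ≤ θ.froProd ℓ m :=
  Finset.prod_nonneg fun j _ => θ.fro_nonneg j

lemma froProd_self (ℓ : ℕ) : θ.froProd ℓ ℓ = 1 := by simp [froProd]

lemma froProd_succ {ℓ m : ℕ} (h : ℓ ≤ m) : θ.froProd ℓ (m + 1) = θ.froProd ℓ m * θ.fro m :=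
  Finset.prod_Ico_succ_top h _

lemma froProd_mul {ℓ m n : ℕ} (h : ℓ ≤ m) (h' : m ≤ n) :
    θ.froProd ℓ m * θ.froProd m n = θ.froProd ℓ n :=
  Finset.prod_Ico_consecutive _ h h'

lemma sum_frobSq_le_normSq : ∑ ℓ ∈ Finset.range L, θ.fro ℓ ^ 2 ≤ θ.normSq := by
  refine Finset.sum_le_sum fun ℓ _ => ?_
  rw [fro_sq]
  exact le_add_of_nonneg_right (by positivity)

variable {θ} {a : ℝ} (x y : EuclideanSpace ℝ (Fin din))

lemma preact_succ_sub (ℓ : ℕ) : θ.preact a x (ℓ + 1) - θ.preact a y (ℓ + 1) =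
    θ.W ℓ *ᵥ (θ.act a x ℓ - θ.act a y ℓ) := by
  simp only [preact, Matrix.mulVec_sub]; abel

lemma euclNorm_act_sub_le_preact (ha : |a| ≤ 1) : ∀ ℓ : ℕ, euclNorm (θ.act a x ℓ - θ.act a y ℓ) ≤
    euclNorm (θ.preact a x ℓ - θ.preact a y ℓ)
  | 0 => le_rfl
  | ℓ + 1 => by
    rw [euclNorm_le_iff]
    refine Finset.sum_le_sum fun i _ => ?_
    rw [sq_le_sq]
    exact abs_sigmaA_sub_le ha _ _

lemma euclNorm_act_sub_le_froProd (ha : |a| ≤ 1) {ℓ m : ℕ} (h : ℓ ≤ m) :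
    euclNorm (θ.act a x m - θ.act a y m) ≤
      θ.froProd ℓ m * euclNorm (θ.act a x ℓ - θ.act a y ℓ) := by
  induction m, h using Nat.le_induction with
  | base => rw [froProd_self, one_mul]
  | succ m h ih =>
    refine (euclNorm_act_sub_le_preact x y ha (m + 1)).trans ?_
    rw [preact_succ_sub, θ.froProd_succ h, mul_comm (θ.froProd ℓ m), mul_assoc]
    exact (euclNorm_mulVec_le _ _).trans (mul_le_mul_of_nonneg_left ih (θ.fro_nonneg m))

lemma euclNorm_preact_sub_le_froProd (ha : |a| ≤ 1) {ℓ m : ℕ} (h : ℓ < m) :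
    euclNorm (θ.preact a x m - θ.preact a y m) ≤
      θ.froProd ℓ m * euclNorm (θ.act a x ℓ - θ.act a y ℓ) := by
  obtain ⟨m, rfl⟩ := Nat.exists_eq_add_of_lt h
  rw [preact_succ_sub, θ.froProd_succ (Nat.le_add_right ℓ m), mul_comm (θ.froProd ℓ _), mul_assoc]
  exact (euclNorm_mulVec_le _ _).trans (mul_le_mul_of_nonneg_left
    (euclNorm_act_sub_le_froProd x y ha (Nat.le_add_right ℓ m)) (θ.fro_nonneg _))

lemma euclNorm_preact_sub_le_froProd_preact (ha : |a| ≤ 1) {ℓ m : ℕ} (h : ℓ ≤ m) :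
    euclNorm (θ.preact a x m - θ.preact a y m) ≤
      θ.froProd ℓ m * euclNorm (θ.preact a x ℓ - θ.preact a y ℓ) := by
  rcases h.eq_or_lt with rfl | h
  · rw [froProd_self, one_mul]
  · exact (euclNorm_preact_sub_le_froProd x y ha h).trans
      (mul_le_mul_of_nonneg_left (euclNorm_act_sub_le_preact x y ha ℓ) (θ.froProd_nonneg _ _))

lemma euclNorm_comp_cast {m n : ℕ} (h : m = n) (v : Fin n → ℝ) :
    euclNorm (fun i : Fin m => v (Fin.cast h i)) = euclNorm v := by
  subst h; rfl

lemma norm_out_sub : ‖θ.out a x - θ.out a y‖ =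
    euclNorm (θ.preact a x L - θ.preact a y L) :=
  euclNorm_comp_cast θ.width_last.symm (θ.preact a x L - θ.preact a y L)

lemma euclNorm_act_zero_sub : euclNorm (θ.act a x 0 - θ.act a y 0) = ‖x - y‖ :=
  euclNorm_comp_cast θ.width_zero (x - y)

end NetParams

/-! ### Forward propagation of tangent vectors and the tangent kernel -/

namespace NetParams

variable {L din dout : ℕ} (θ : NetParams L din dout) (a s : ℝ) (x : EuclideanSpace ℝ (Fin din))

/-- The image of a tangent vector `w` at the input `x` under the chain rule derivative of the
activations of layer `ℓ`. -/
noncomputable def tanAct (w : Fin (θ.width 0) → ℝ) : (ℓ : ℕ) → Fin (θ.width ℓ) → ℝ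
  | 0 => w
  | ℓ + 1 => fun i => dSigmaA a s (θ.preact a x (ℓ + 1) i) * (θ.W ℓ *ᵥ tanAct w ℓ) i

/-- The image of a tangent vector `w` at the input `x` under the chain rule derivative of the
pre-activations of layer `ℓ`. -/
noncomputable def tanPreact (w : Fin (θ.width 0) → ℝ) : (ℓ : ℕ) → Fin (θ.width ℓ) → ℝ
  | 0 => w
  | ℓ + 1 => θ.W ℓ *ᵥ θ.tanAct a s x w ℓ

variable {a s}

lemma euclNorm_tanAct_le (ha : |a| ≤ 1) (hs : |s| ≤ 1) (w : Fin (θ.width 0) → ℝ) (m : ℕ) :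
    euclNorm (θ.tanAct a s x w m) ≤ θ.froProd 0 m * euclNorm w := by
  induction m with
  | zero => rw [froProd_self, one_mul]; exact le_rfl
  | succ m ih =>
    calc euclNorm (θ.tanAct a s x w (m + 1)) ≤ euclNorm (θ.W m *ᵥ θ.tanAct a s x w m) := by
          rw [euclNorm_le_iff]
          refine Finset.sum_le_sum fun i _ => ?_
          rw [sq_le_sq, tanAct, abs_mul]
          exact mul_le_of_le_one_left (abs_nonneg _) (abs_dSigmaA_le ha hs _)
      _ ≤ θ.fro m * (θ.froProd 0 m * euclNorm w) :=
          (euclNorm_mulVec_le _ _).trans (mul_le_mul_of_nonneg_left ih (θ.fro_nonneg m))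
      _ = _ := by rw [θ.froProd_succ (Nat.zero_le m)]; ring

lemma euclNorm_tanPreact_succ_le (ha : |a| ≤ 1) (hs : |s| ≤ 1) (w : Fin (θ.width 0) → ℝ) (m : ℕ) :
    euclNorm (θ.tanPreact a s x w (m + 1)) ≤ θ.froProd 0 (m + 1) * euclNorm w := by
  rw [θ.froProd_succ (Nat.zero_le m), mul_comm (θ.froProd 0 m), mul_assoc]
  exact (euclNorm_mulVec_le _ _).trans
    (mul_le_mul_of_nonneg_left (θ.euclNorm_tanAct_le x ha hs w m) (θ.fro_nonneg m))

lemma dAct_single_of_le (ℓ : ℕ) (M : Matrix (Fin (θ.width (ℓ + 1))) (Fin (θ.width ℓ)) ℝ) :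
    ∀ m ≤ ℓ, θ.dAct a s (Pi.single ℓ M) x m = 0
  | 0, _ => rfl
  | m + 1, h => by
    have h1 : (Pi.single ℓ M :
        (ℓ : ℕ) → Matrix (Fin (θ.width (ℓ + 1))) (Fin (θ.width ℓ)) ℝ) m = 0 :=
      Pi.single_eq_of_ne (by omega) _
    ext i
    simp [dAct, h1, dAct_single_of_le ℓ M m (by omega)]

/-- The derivative of the pre-activations with respect to the weights of layer `ℓ` in terms of the
propagated tangent vector. -/
lemma act_smul_tanPreact (w : Fin (θ.width 0) → ℝ) (ℓ : ℕ) (j : Fin (θ.width ℓ)) (m : ℕ)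
    (h : ℓ ≤ m) : θ.act a x ℓ j • θ.tanPreact a s x w (m + 1) =
      ∑ i, θ.tanPreact a s x w (ℓ + 1) i •
        θ.dPreact a s (Pi.single ℓ (Matrix.single i j 1)) x (m + 1) := by
  -- Both sides are the Jacobian from the pre-activations of layer `ℓ + 1` applied to the same
  -- multiple of the propagated tangent vector; each induction step applies one more layer to both.
  induction m, h using Nat.le_induction with
  | base =>
    have h1 : ∀ i, θ.dPreact a s (Pi.single ℓ (Matrix.single i j 1)) x (ℓ + 1) =
        θ.act a x ℓ j • Pi.single i 1 := fun i => by
      rw [dPreact, dAct_single_of_le θ x ℓ _ ℓ le_rfl, Matrix.mulVec_zero, add_zero,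
        Pi.single_eq_same]
      ext k
      simp [Matrix.single_mulVec, Pi.single_apply, Function.update_apply]
    simp_rw [h1]
    ext k
    simp [Pi.single_apply, mul_comm]
  | succ m h ih =>
    have hV : ∀ i, (Pi.single ℓ (Matrix.single i j 1) :
        (ℓ : ℕ) → Matrix (Fin (θ.width (ℓ + 1))) (Fin (θ.width ℓ)) ℝ) (m + 1) = 0 := fun i =>
      Pi.single_eq_of_ne (by omega) _
    have hact : θ.act a x ℓ j • θ.tanAct a s x w (m + 1) =
        ∑ i, θ.tanPreact a s x w (ℓ + 1) i •
          θ.dAct a s (Pi.single ℓ (Matrix.single i j 1)) x (m + 1) := by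
      ext k
      have hk := congrFun ih k
      simp only [Pi.smul_apply, smul_eq_mul, Finset.sum_apply] at hk ⊢
      calc θ.act a x ℓ j * θ.tanAct a s x w (m + 1) k
          = dSigmaA a s (θ.preact a x (m + 1) k) *
            (θ.act a x ℓ j * θ.tanPreact a s x w (m + 1) k) := by
              simp only [tanAct, tanPreact]; ring
        _ = _ := by
          rw [hk, Finset.mul_sum]
          refine Finset.sum_congr rfl fun i _ => ?_
          simp only [dAct, dPreact, Pi.add_apply]; ring
    have hd : ∀ i, θ.dPreact a s (Pi.single ℓ (Matrix.single i j 1)) x (m + 1 + 1) =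
        θ.W (m + 1) *ᵥ θ.dAct a s (Pi.single ℓ (Matrix.single i j 1)) x (m + 1) := fun i => by
      rw [dPreact, hV, Matrix.zero_mulVec, zero_add]
    simp_rw [hd]
    rw [tanPreact, ← Matrix.mulVec_smul, hact, Matrix.mulVec_sum]
    simp_rw [Matrix.mulVec_smul]

/-- Cauchy-Schwarz over `i` in `act_smul_tanPreact`, summed over `j` and `k`. The Jacobian from
layer `ℓ + 1` to the output is thus bounded below by the ratio of the lengths of one tangent vector
at the two ends, without any backward propagation. -/
lemma sq_euclNorm_act_mul_tanPreact_le (w : Fin (θ.width 0) → ℝ) {ℓ : ℕ} (h : ℓ < L) :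
    euclNorm (θ.act a x ℓ) ^ 2 * euclNorm (θ.tanPreact a s x w L) ^ 2 ≤
      euclNorm (θ.tanPreact a s x w (ℓ + 1)) ^ 2 *
        ∑ k, ∑ i, ∑ j, θ.dOut a s ℓ i j x k * θ.dOut a s ℓ i j x k := by
  have key : ∀ (j : Fin (θ.width ℓ)) (k : Fin dout),
      (θ.act a x ℓ j * θ.tanPreact a s x w L (Fin.cast θ.width_last.symm k)) ^ 2 ≤
        euclNorm (θ.tanPreact a s x w (ℓ + 1)) ^ 2 * ∑ i, θ.dOut a s ℓ i j x k ^ 2 := by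
    intro j k
    obtain ⟨m, hm⟩ : ∃ m, L = m + 1 := ⟨L - 1, by omega⟩
    have h1 := θ.act_smul_tanPreact (a := a) (s := s) x w ℓ j m (by omega)
    rw [← hm] at h1
    have h2 := congrFun h1 (Fin.cast θ.width_last.symm k)
    simp only [Pi.smul_apply, smul_eq_mul, Finset.sum_apply] at h2
    rw [h2, euclNorm_sq]
    exact Finset.sum_mul_sq_le_sq_mul_sq _ _ _
  have hw : euclNorm (θ.tanPreact a s x w L) ^ 2 =
      ∑ k : Fin dout, θ.tanPreact a s x w L (Fin.cast θ.width_last.symm k) ^ 2 := by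
    rw [← euclNorm_sq, euclNorm_comp_cast]
  rw [hw, euclNorm_sq (θ.act a x ℓ), Finset.sum_mul_sum, Finset.sum_comm, Finset.mul_sum]
  refine Finset.sum_le_sum fun k _ => ?_
  rw [Finset.sum_comm, Finset.mul_sum]
  refine Finset.sum_le_sum fun j _ => ?_
  rw [← mul_pow]
  simpa only [sq] using key j k

lemma trace_ntk : (θ.ntk a s x x).trace = ∑ ℓ ∈ Finset.range L,
    ∑ k, ∑ i, ∑ j, θ.dOut a s ℓ i j x k * θ.dOut a s ℓ i j x k := by
  rw [Matrix.trace, Finset.sum_comm]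
  rfl

/-- Lower bound on the trace of the tangent kernel by the contributions of a set `G` of layers. -/
lemma card_mul_le_trace_ntk (w : Fin (θ.width 0) → ℝ) {q : ℝ} (T : ℕ → ℝ) (G : Finset ℕ)
    (hG : G ⊆ Finset.range L) (hT : ∀ ℓ ∈ G, 0 < T ℓ)
    (htan : ∀ ℓ ∈ G, euclNorm (θ.tanPreact a s x w (ℓ + 1)) ≤ T ℓ)
    (hq : ∀ ℓ ∈ G, q * T ℓ ^ 2 ≤
      euclNorm (θ.act a x ℓ) ^ 2 * euclNorm (θ.tanPreact a s x w L) ^ 2) :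
    G.card * q ≤ (θ.ntk a s x x).trace := by
  rw [trace_ntk, ← nsmul_eq_mul]
  have hnn : ∀ ℓ, 0 ≤ ∑ k, ∑ i, ∑ j, θ.dOut a s ℓ i j x k * θ.dOut a s ℓ i j x k := fun ℓ =>
    Finset.sum_nonneg fun _ _ => Finset.sum_nonneg fun _ _ => Finset.sum_nonneg fun _ _ =>
      mul_self_nonneg _
  refine (Finset.card_nsmul_le_sum G _ q fun ℓ hℓ => ?_).trans
    (Finset.sum_le_sum_of_subset_of_nonneg hG fun ℓ _ _ => hnn ℓ)
  have h1 := (hq ℓ hℓ).trans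
    (θ.sq_euclNorm_act_mul_tanPreact_le (s := s) x w (Finset.mem_range.1 (hG hℓ)))
  have h2 : euclNorm (θ.tanPreact a s x w (ℓ + 1)) ^ 2 ≤ T ℓ ^ 2 :=
    pow_le_pow_left₀ (euclNorm_nonneg _) (htan ℓ hℓ) 2
  have h3 := h1.trans (mul_le_mul_of_nonneg_right h2 (hnn ℓ))
  rw [mul_comm] at h3
  exact le_of_mul_le_mul_left h3 (pow_pos (hT ℓ hℓ) 2)

end NetParams

/-! ### Derivatives off a countable set -/

/-- A zero with nonzero derivative is isolated among the zeros, and a discrete subset of the line is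
countable. -/
lemma countable_zeros_with_deriv_ne_zero (u : ℝ → ℝ) :
    {t : ℝ | u t = 0 ∧ ∃ c : ℝ, c ≠ 0 ∧ HasDerivAt u c t}.Countable := by
  set S := {t : ℝ | u t = 0 ∧ ∃ c : ℝ, c ≠ 0 ∧ HasDerivAt u c t}
  have : DiscreteTopology S := by
    rw [discreteTopology_subtype_iff]
    rintro t ⟨_, c, hc, hd⟩
    rw [← disjoint_iff, Filter.disjoint_principal_right]
    filter_upwards [hd.eventually_ne (c := 0) hc] with z hz hzS
    exact hz hzS.1
  exact countable_of_Lindelof_of_discrete (X := S)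

/-- At the kink the inner derivative is required to vanish; the Lipschitz bound then gives
derivative `0`, which is the chain rule value whatever `s` is. -/
lemma HasDerivAt.sigmaA_comp {a s : ℝ} (ha : |a| ≤ 1) {u : ℝ → ℝ} {c t : ℝ}
    (h : HasDerivAt u c t) (h0 : u t = 0 → c = 0) :
    HasDerivAt (fun t => sigmaA a (u t)) (dSigmaA a s (u t) * c) t := by
  rcases lt_trichotomy (u t) 0 with hu | hu | hu
  · have h1 : dSigmaA a s (u t) = a := by simp [dSigmaA, hu, hu.le.not_gt]
    rw [h1]
    refine (h.const_mul a).congr_of_eventuallyEq ?_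
    filter_upwards [h.continuousAt.eventually_lt_const hu] with z hz
    simp [sigmaA, hz]
  · obtain rfl := h0 hu
    rw [mul_zero]
    rw [hasDerivAt_iff_isLittleO] at h ⊢
    simp only [smul_zero, sub_zero] at h ⊢
    refine Asymptotics.IsBigO.trans_isLittleO (Asymptotics.IsBigO.of_bound 1 ?_) h
    filter_upwards with z
    simpa using abs_sigmaA_sub_le ha (u z) (u t)
  · have h1 : dSigmaA a s (u t) = 1 := by simp [dSigmaA, hu]
    rw [h1, one_mul]
    refine h.congr_of_eventuallyEq ?_
    filter_upwards [h.continuousAt.eventually_const_lt hu] with z hz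
    simp [sigmaA, hz.le]

/-- Mean value inequality for a curve which is differentiable off a countable set. -/
lemma exists_lt_norm_deriv_of_off_countable {E : Type*} [NormedAddCommGroup E] [NormedSpace ℝ E]
    [CompleteSpace E] {g g' : ℝ → E} {b c K : ℝ} {Z : Set ℝ} (hZ : Z.Countable) (hbc : b ≤ c)
    (hg : ContinuousOn g (Icc b c)) (hd : ∀ t ∈ Ioo b c \ Z, HasDerivAt g (g' t) t)
    (hK : K * (c - b) < ‖g c - g b‖) : ∃ t ∈ Ioo b c \ Z, K < ‖g' t‖ := by
  by_contra! hcon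
  borelize E
  have hae : ∀ᵐ t : ℝ, t ∈ uIoc b c → ‖deriv g t‖ ≤ K := by
    have h1 : ∀ᵐ t : ℝ, t ∉ Z := (hZ.ae_notMem volume)
    have h2 : ∀ᵐ t : ℝ, t ≠ c := by simpa using (countable_singleton c).ae_notMem volume
    filter_upwards [h1, h2] with t ht1 ht2 ht
    rw [uIoc_of_le hbc] at ht
    have ht' : t ∈ Ioo b c \ Z := ⟨⟨ht.1, lt_of_le_of_ne ht.2 ht2⟩, ht1⟩
    rw [(hd t ht').deriv]
    exact hcon t ht'
  have hint : IntervalIntegrable (deriv g) volume b c := by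
    rw [intervalIntegrable_iff]
    refine Measure.integrableOn_of_bounded (M := K) (by simp) ?_ ?_
    · exact (stronglyMeasurable_deriv g).aestronglyMeasurable
    · rw [ae_restrict_iff' measurableSet_uIoc]
      exact hae
  have hftc := integral_eq_of_hasDerivAt_off_countable g (deriv g) hZ (by rwa [uIcc_of_le hbc])
    (by
      rw [min_eq_left hbc, max_eq_right hbc]
      intro t ht
      rw [(hd t ht).deriv]
      exact hd t ht) hint
  have := intervalIntegral.norm_integral_le_of_norm_le_const_ae hae
  rw [hftc, abs_of_nonneg (by linarith)] at this
  linarith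

namespace NetParams

variable {L din dout : ℕ} (θ : NetParams L din dout) {a : ℝ}

lemma continuous_preact (ha : |a| ≤ 1) (m : ℕ) : Continuous fun x => θ.preact a x m := by
  have key : ∀ m, Continuous (fun x => θ.preact a x m) ∧ Continuous (fun x => θ.act a x m) := by
    intro m
    induction m with
    | zero =>
      have : Continuous fun (x : EuclideanSpace ℝ (Fin din)) (i : Fin (θ.width 0)) =>
        x (Fin.cast θ.width_zero i) := by fun_prop
      exact ⟨this, this⟩
    | succ m ih =>
      have h1 : Continuous fun x => θ.preact a x (m + 1) := by
        simp only [preact]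
        exact (Continuous.matrix_mulVec continuous_const ih.2).add continuous_const
      exact ⟨h1, continuous_pi fun i =>
        (continuous_sigmaA ha).comp ((continuous_apply i).comp h1)⟩
  exact (key m).1

lemma continuous_out (ha : |a| ≤ 1) : Continuous (θ.out a) := by
  have := θ.continuous_preact ha L
  unfold out
  refine (PiLp.continuous_toLp 2 _).comp ?_
  exact continuous_pi fun k => (continuous_apply _).comp this

/-- Along a differentiable curve, the chain rule derivative of the activations is the derivative of
the activations off a countable set. -/
lemma exists_countable_hasDerivAt (ha : |a| ≤ 1) (s : ℝ) {γ γ' : ℝ → EuclideanSpace ℝ (Fin din)}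
    {I : Set ℝ} (hγ : ∀ t ∈ I, HasDerivAt γ (γ' t) t) (m : ℕ) :
    ∃ Z : Set ℝ, Z.Countable ∧ ∀ t ∈ I \ Z,
      (∀ i, HasDerivAt (fun t => θ.act a (γ t) m i)
        (θ.tanAct a s (γ t) (fun i => γ' t (Fin.cast θ.width_zero i)) m i) t) ∧
      (∀ i, HasDerivAt (fun t => θ.preact a (γ t) m i)
        (θ.tanPreact a s (γ t) (fun i => γ' t (Fin.cast θ.width_zero i)) m i) t) := by
  induction m with
  | zero =>
    refine ⟨∅, countable_empty, fun t ht => ?_⟩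
    have h := hγ t ht.1
    have h2 : ∀ i : Fin din, HasDerivAt (fun t => γ t i) (γ' t i) t := fun i =>
      (EuclideanSpace.proj (𝕜 := ℝ) i).hasFDerivAt.comp_hasDerivAt t h
    exact ⟨fun i => h2 _, fun i => h2 _⟩
  | succ m ih =>
    obtain ⟨Z, hZ, hd⟩ := ih
    have hpre : ∀ t ∈ I \ Z, ∀ i, HasDerivAt (fun t => θ.preact a (γ t) (m + 1) i)
        (θ.tanPreact a s (γ t) (fun i => γ' t (Fin.cast θ.width_zero i)) (m + 1) i) t := by
      intro t ht i
      simp only [preact, tanPreact, Pi.add_apply, Matrix.mulVec, dotProduct]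
      exact (HasDerivAt.fun_sum fun j _ => ((hd t ht).1 j).const_mul (θ.W m i j)).add_const _
    -- Only the times at which some neuron crosses its kink with nonzero speed have to be added to
    -- the exceptional set.
    refine ⟨Z ∪ ⋃ i, {t : ℝ | θ.preact a (γ t) (m + 1) i = 0 ∧
      ∃ c : ℝ, c ≠ 0 ∧ HasDerivAt (fun t => θ.preact a (γ t) (m + 1) i) c t},
      hZ.union (countable_iUnion fun i => countable_zeros_with_deriv_ne_zero _), ?_⟩
    rintro t ⟨htI, htZ⟩
    rw [mem_union, not_or, mem_iUnion, not_exists] at htZ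
    refine ⟨fun i => ?_, hpre t ⟨htI, htZ.1⟩⟩
    have h := hpre t ⟨htI, htZ.1⟩ i
    exact h.sigmaA_comp ha fun h0 => by_contra fun hne => htZ.2 i ⟨h0, _, hne, h⟩

/-- If the network function moves fast along a curve, then the chain rule derivative in the
direction of the curve is large somewhere. -/
lemma exists_lt_euclNorm_tanPreact (ha : |a| ≤ 1) (s : ℝ)
    {γ γ' : ℝ → EuclideanSpace ℝ (Fin din)} {b c K : ℝ} (hbc : b ≤ c)
    (hγ : ∀ t ∈ Icc b c, HasDerivAt γ (γ' t) t)
    (hK : K * (c - b) < ‖θ.out a (γ c) - θ.out a (γ b)‖) :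
    ∃ t ∈ Ioo b c,
      K < euclNorm (θ.tanPreact a s (γ t) (fun i => γ' t (Fin.cast θ.width_zero i)) L) := by
  obtain ⟨Z, hZ, hd⟩ := θ.exists_countable_hasDerivAt ha s hγ L
  obtain ⟨t, ht, htK⟩ := exists_lt_norm_deriv_of_off_countable (g := fun t => θ.out a (γ t))
    (g' := fun t => WithLp.toLp 2 fun k : Fin dout => θ.tanPreact a s (γ t)
      (fun i => γ' t (Fin.cast θ.width_zero i)) L (Fin.cast θ.width_last.symm k)) hZ hbc
    ((θ.continuous_out ha).comp_continuousOn fun t ht => (hγ t ht).continuousAt.continuousWithinAt)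
    (fun t ht => by
      have h := hasDerivAt_pi.2 fun k : Fin dout =>
        (hd t ⟨Ioo_subset_Icc_self ht.1, ht.2⟩).2 (Fin.cast θ.width_last.symm k)
      exact (EuclideanSpace.equiv (Fin dout) ℝ).symm.hasFDerivAt.comp_hasDerivAt t h) hK
  refine ⟨t, ht.1, htK.trans_le (le_of_eq ?_)⟩
  exact euclNorm_comp_cast θ.width_last.symm (θ.tanPreact a s (γ t)
    (fun i => γ' t (Fin.cast θ.width_zero i)) L)

end NetParams

/-! ### A layer whose weight matrix is nearly of rank one -/

namespace NetParams

variable {L din dout : ℕ} (θ : NetParams L din dout) {a : ℝ}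

/-- The inequality `t ≤ e^{t-1}` in each factor: a norm budget of about one per layer bounds the
whole product independently of the depth. -/
lemma prod_sq_le_exp (S : Finset ℕ) :
    (∏ j ∈ S, θ.fro j) ^ 2 ≤ Real.exp (∑ j ∈ S, (θ.fro j ^ 2 - 1)) := by
  rw [← Finset.prod_pow, Real.exp_sum]
  refine Finset.prod_le_prod (fun j _ => sq_nonneg _) fun j _ => ?_
  have := Real.add_one_le_exp (θ.fro j ^ 2 - 1)
  linarith

lemma froProd_sq_le_exp {c : ℝ} (hc : θ.normSq = L + c) : θ.froProd 0 L ^ 2 ≤ Real.exp c := by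
  refine (θ.prod_sq_le_exp _).trans (Real.exp_le_exp.2 ?_)
  have h := θ.sum_frobSq_le_normSq
  rw [Finset.sum_sub_distrib, ← Finset.range_eq_Ico]
  simp
  linarith

/-- Dropping a layer removes `fro ℓ ^ 2 - 1 ≥ -1` from the exponent, which costs at most a factor
`e`. -/
lemma froProd_mul_froProd_succ_sq_le_exp {c : ℝ} (hc : θ.normSq = L + c) {ℓ : ℕ} (h : ℓ < L) :
    (θ.froProd 0 ℓ * θ.froProd (ℓ + 1) L) ^ 2 ≤ Real.exp (c + 1) := by
  have h1 : θ.froProd 0 ℓ * θ.froProd (ℓ + 1) L = ∏ j ∈ (Finset.range L).erase ℓ, θ.fro j := by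
    rw [froProd, froProd, ← Finset.prod_union]
    · refine Finset.prod_congr ?_ fun _ _ => rfl
      ext j; simp only [Finset.mem_union, Finset.mem_Ico, Finset.mem_erase, Finset.mem_range]; omega
    · rw [Finset.disjoint_left]
      intro j; simp only [Finset.mem_Ico]; omega
  rw [h1]
  refine (θ.prod_sq_le_exp _).trans (Real.exp_le_exp.2 ?_)
  have h2 := Finset.add_sum_erase (Finset.range L) (fun j => θ.fro j ^ 2 - 1)
    (Finset.mem_range.2 h)
  have h3 : ∑ j ∈ Finset.range L, (θ.fro j ^ 2 - 1) ≤ c := by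
    have h := θ.sum_frobSq_le_normSq
    rw [Finset.sum_sub_distrib]
    simp
    linarith
  have h4 := sq_nonneg (θ.fro ℓ)
  linarith

/-- If a network of almost minimal norm separates two points, then some late weight matrix is close
to having rank one. -/
lemma exists_layer_near_rank_one (ha : |a| ≤ 1) {x y : EuclideanSpace ℝ (Fin din)} {r D c : ℝ}
    (hr : 0 < r) (hxy : ‖x - y‖ ≤ D) (hout : r ≤ ‖θ.out a x - θ.out a y‖)
    (hc : θ.normSq = L + c) {M : ℕ} (hM : M < L) :
    ∃ ℓ, M ≤ ℓ ∧ ℓ < L ∧ ∃ u : Fin (θ.width (ℓ + 1)) → ℝ, euclNorm u = 1 ∧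
      ∀ v, euclNorm (θ.W ℓ *ᵥ v - (u ⬝ᵥ θ.W ℓ *ᵥ v) • u) ^ 2 ≤
        (c + 2 * Real.log (D / r)) / (L - M) * euclNorm v ^ 2 := by
  set z : (ℓ : ℕ) → Fin (θ.width ℓ) → ℝ := fun ℓ => θ.act a x ℓ - θ.act a y ℓ with hz
  set d : ℕ → ℝ := fun ℓ => euclNorm (z ℓ) with hd
  set e : ℕ → ℝ := fun ℓ => euclNorm (θ.preact a x ℓ - θ.preact a y ℓ) with he
  have heL : r ≤ e L := by rw [norm_out_sub] at hout; exact hout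
  have he0 : e 0 ≤ D := by
    have : e 0 = ‖x - y‖ := by rw [← euclNorm_act_zero_sub (θ := θ) (a := a)]; rfl
    rwa [this]
  have heW : ∀ ℓ, e (ℓ + 1) = euclNorm (θ.W ℓ *ᵥ z ℓ) := fun ℓ => by
    simp only [he, preact_succ_sub, hz]
  have hde : ∀ ℓ, d ℓ ≤ e ℓ := fun ℓ => euclNorm_act_sub_le_preact x y ha ℓ
  have hdpos : ∀ ℓ < L, 0 < d ℓ := fun ℓ hℓ => by
    have h1 := euclNorm_preact_sub_le_froProd (θ := θ) x y ha hℓ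
    have h2 : 0 < θ.froProd ℓ L * d ℓ := hr.trans_le (heL.trans h1)
    exact pos_of_mul_pos_right h2 (θ.froProd_nonneg _ _)
  have hepos : ∀ ℓ ≤ L, 0 < e ℓ := fun ℓ hℓ => by
    rcases hℓ.eq_or_lt with rfl | h
    · exact hr.trans_le heL
    · exact (hdpos ℓ h).trans_le (hde ℓ)
  set g : ℕ → ℝ := fun ℓ => θ.fro ℓ ^ 2 - (e (ℓ + 1) / d ℓ) ^ 2 with hg
  have hg0 : ∀ ℓ < L, 0 ≤ g ℓ := fun ℓ hℓ => by
    have h1 := sq_euclNorm_mulVec_le (θ.W ℓ) (z ℓ)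
    rw [← heW, ← fro_sq] at h1
    rw [hg, sub_nonneg, div_pow, div_le_iff₀ (pow_pos (hdpos ℓ hℓ) 2)]
    exact h1
  -- `log t ≤ t - 1` for the squared gain `t`; replacing `d ℓ` by the larger `e ℓ` makes the
  -- logarithms telescope over the layers.
  have hlog : ∀ ℓ < L, 1 + 2 * (Real.log (e (ℓ + 1)) - Real.log (e ℓ)) ≤
      (e (ℓ + 1) / d ℓ) ^ 2 := fun ℓ hℓ => by
    have h1 : 0 < (e (ℓ + 1) / d ℓ) ^ 2 := pow_pos (div_pos (hepos _ hℓ) (hdpos ℓ hℓ)) 2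
    have h2 := Real.log_le_sub_one_of_pos h1
    rw [Real.log_pow, Real.log_div (hepos _ hℓ).ne' (hdpos ℓ hℓ).ne'] at h2
    have h3 := Real.log_le_log (hdpos ℓ hℓ) (hde ℓ)
    push_cast at h2
    linarith
  have hDpos : 0 < D := (hepos 0 (Nat.zero_le _)).trans_le he0
  have hsum : ∑ ℓ ∈ Finset.range L, g ℓ ≤ c + 2 * Real.log (D / r) := by
    have h1 := θ.sum_frobSq_le_normSq
    have h2 := Finset.sum_le_sum fun ℓ hℓ => hlog ℓ (Finset.mem_range.1 hℓ)
    rw [Finset.sum_add_distrib, ← Finset.mul_sum,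
      Finset.sum_range_sub (fun ℓ => Real.log (e ℓ))] at h2
    have h3 := Real.log_le_log hr heL
    have h4 := Real.log_le_log (hepos 0 (Nat.zero_le _)) he0
    rw [Real.log_div hDpos.ne' hr.ne']
    simp only [hg, Finset.sum_sub_distrib]
    simp only [Finset.sum_const, Finset.card_range, nsmul_eq_mul, mul_one] at h2
    linarith
  have hsum' : ∑ ℓ ∈ Finset.Ico M L, g ℓ ≤ c + 2 * Real.log (D / r) :=
    (Finset.sum_le_sum_of_subset_of_nonneg
      (fun ℓ hℓ => Finset.mem_range.2 (Finset.mem_Ico.1 hℓ).2)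
      fun ℓ hℓ _ => hg0 ℓ (Finset.mem_range.1 hℓ)).trans hsum
  have hML : (0 : ℝ) < L - M := sub_pos.2 (by exact_mod_cast hM)
  obtain ⟨ℓ, hℓ, hgl⟩ : ∃ ℓ ∈ Finset.Ico M L, g ℓ ≤ (c + 2 * Real.log (D / r)) / (L - M) := by
    refine Finset.exists_le_of_sum_le (Finset.nonempty_Ico.2 hM) (hsum'.trans (le_of_eq ?_))
    rw [Finset.sum_const, Nat.card_Ico, nsmul_eq_mul, Nat.cast_sub hM.le]
    field_simp
  rw [Finset.mem_Ico] at hℓ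
  -- The distinguished direction is that of the image of the given pair's difference.
  refine ⟨ℓ, hℓ.1, hℓ.2, (e (ℓ + 1))⁻¹ • (θ.W ℓ *ᵥ z ℓ), ?_, fun v => ?_⟩
  · rw [euclNorm_smul, ← heW, abs_of_pos (inv_pos.2 (hepos _ hℓ.2)),
      inv_mul_cancel₀ (hepos _ hℓ.2).ne']
  · set u := (e (ℓ + 1))⁻¹ • (θ.W ℓ *ᵥ z ℓ) with hu
    have hu1 : euclNorm u = 1 := by
      rw [hu, euclNorm_smul, ← heW, abs_of_pos (inv_pos.2 (hepos _ hℓ.2)),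
        inv_mul_cancel₀ (hepos _ hℓ.2).ne']
    have hue : u ⬝ᵥ θ.W ℓ *ᵥ z ℓ = e (ℓ + 1) := by
      have : (θ.W ℓ *ᵥ z ℓ) ⬝ᵥ (θ.W ℓ *ᵥ z ℓ) = e (ℓ + 1) ^ 2 := by
        rw [heW, euclNorm_sq]; exact Finset.sum_congr rfl fun i _ => (sq _).symm
      rw [hu, smul_dotProduct, this, smul_eq_mul, sq, ← mul_assoc,
        inv_mul_cancel₀ (hepos _ hℓ.2).ne', one_mul]
    have h1 := sq_euclNorm_mulVec_sub_le (θ.W ℓ) u hu1 (z ℓ) v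
    rw [hue, ← fro_sq] at h1
    have h2 : θ.fro ℓ ^ 2 * euclNorm (z ℓ) ^ 2 - e (ℓ + 1) ^ 2 = d ℓ ^ 2 * g ℓ := by
      have := (hdpos ℓ hℓ.2).ne'
      simp only [hg]
      field_simp
      rfl
    rw [h2, mul_assoc] at h1
    exact (le_of_mul_le_mul_left h1 (pow_pos (hdpos ℓ hℓ.2) 2)).trans
      (mul_le_mul_of_nonneg_right hgl (sq_nonneg _))

/-- The outputs of a network of almost minimal norm are determined, up to a small error, by a scalar
function `p` which is Lipschitz as a function of the activations of each layer in the first half of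
the network. -/
lemma exists_scalar_coordinate (ha : |a| ≤ 1) {x₁ x₂ : EuclideanSpace ℝ (Fin din)} {r D c : ℝ}
    (hr : 0 < r) (hxy : ‖x₁ - x₂‖ ≤ D) (hout : r ≤ ‖θ.out a x₁ - θ.out a x₂‖)
    (hc : θ.normSq = L + c) {M : ℕ} (hM : M < L) {ε : ℝ} (hε : 0 ≤ ε)
    (hεL : Real.exp (c + 1) * ((c + 2 * Real.log (D / r)) / (L - M)) * D ^ 2 ≤ ε ^ 2) :
    ∃ p : EuclideanSpace ℝ (Fin din) → ℝ, Continuous p ∧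
      (∀ x y, ‖x - y‖ ≤ D → ‖θ.out a x - θ.out a y‖ ≤ |p x - p y| + ε) ∧
      ∀ ℓ ≤ M, ∀ x y, |p x - p y| ≤
        θ.froProd ℓ L * euclNorm (θ.act a x ℓ - θ.act a y ℓ) := by
  obtain ⟨m, hMm, hmL, u, hu, hW⟩ := θ.exists_layer_near_rank_one ha hr hxy hout hc hM
  set q := (c + 2 * Real.log (D / r)) / (L - M) with hq
  have hq0 : 0 ≤ q := by
    have h1 : 0 < euclNorm (θ.act a x₁ m - θ.act a x₂ m) := by
      rw [norm_out_sub] at hout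
      exact pos_of_mul_pos_right
        (hr.trans_le (hout.trans (euclNorm_preact_sub_le_froProd x₁ x₂ ha hmL)))
        (θ.froProd_nonneg _ _)
    exact nonneg_of_mul_nonneg_left ((sq_nonneg _).trans (hW (θ.act a x₁ m - θ.act a x₂ m)))
      (pow_pos h1 2)
  set B := θ.froProd (m + 1) L with hB
  have hB0 : 0 ≤ B := θ.froProd_nonneg _ _
  have hsub : ∀ x y, B * (u ⬝ᵥ θ.preact a x (m + 1)) - B * (u ⬝ᵥ θ.preact a y (m + 1)) =
      B * (u ⬝ᵥ θ.W m *ᵥ (θ.act a x m - θ.act a y m)) := fun x y => by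
    rw [← preact_succ_sub, dotProduct_sub, mul_sub]
  -- `B` bounds the expansion of the layers after `m`, so the `u`-component scaled by `B` dominates
  -- its effect on the output; the orthogonal component accounts for `ε`.
  refine ⟨fun x => B * (u ⬝ᵥ θ.preact a x (m + 1)), ?_, fun x y hxyD => ?_, fun ℓ hℓ x y => ?_⟩
  · exact continuous_const.mul (continuous_const.dotProduct (θ.continuous_preact ha (m + 1)))
  · simp only [hsub]
    set v := θ.act a x m - θ.act a y m with hv
    have h1 : ‖θ.out a x - θ.out a y‖ ≤ B * euclNorm (θ.W m *ᵥ v) := by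
      rw [norm_out_sub, hv, ← preact_succ_sub]
      exact euclNorm_preact_sub_le_froProd_preact x y ha hmL
    have h2 : euclNorm (θ.W m *ᵥ v) ≤
        euclNorm (θ.W m *ᵥ v - (u ⬝ᵥ θ.W m *ᵥ v) • u) + |u ⬝ᵥ θ.W m *ᵥ v| := by
      have := euclNorm_add_le (θ.W m *ᵥ v - (u ⬝ᵥ θ.W m *ᵥ v) • u) ((u ⬝ᵥ θ.W m *ᵥ v) • u)
      rwa [sub_add_cancel, euclNorm_smul, hu, mul_one] at this
    have h3 : B * euclNorm (θ.W m *ᵥ v - (u ⬝ᵥ θ.W m *ᵥ v) • u) ≤ ε := by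
      refine le_of_sq_le_sq ?_ hε
      refine le_trans ?_ hεL
      have hv' : euclNorm v ≤ θ.froProd 0 m * D :=
        (euclNorm_act_sub_le_froProd x y ha (Nat.zero_le m)).trans (by
          rw [euclNorm_act_zero_sub]
          exact mul_le_mul_of_nonneg_left hxyD (θ.froProd_nonneg _ _))
      calc _ = B ^ 2 * euclNorm (θ.W m *ᵥ v - (u ⬝ᵥ θ.W m *ᵥ v) • u) ^ 2 := mul_pow _ _ _
        _ ≤ B ^ 2 * (q * (θ.froProd 0 m * D) ^ 2) := by
          gcongr
          exact (hW v).trans (mul_le_mul_of_nonneg_left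
            (pow_le_pow_left₀ (euclNorm_nonneg v) hv' 2) hq0)
        _ = (θ.froProd 0 m * B) ^ 2 * q * D ^ 2 := by ring
        _ ≤ _ := by
          gcongr
          exact θ.froProd_mul_froProd_succ_sq_le_exp hc hmL
    have h4 : |B * (u ⬝ᵥ θ.W m *ᵥ v)| = B * |u ⬝ᵥ θ.W m *ᵥ v| := by rw [abs_mul, abs_of_nonneg hB0]
    rw [h4]
    nlinarith
  · simp only [hsub]
    rw [abs_mul, abs_of_nonneg hB0, ← preact_succ_sub, ← θ.froProd_mul (by omega : ℓ ≤ m + 1) hmL,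
      mul_comm (θ.froProd ℓ _), mul_assoc]
    refine mul_le_mul_of_nonneg_left ?_ hB0
    refine (abs_dotProduct_le _ _).trans ?_
    rw [hu, one_mul]
    exact euclNorm_preact_sub_le_froProd x y ha (by omega)

end NetParams

/-! ### Separated points on a path -/

/-- Pigeonhole: cells of length `δ` contain at most one of the points each. -/
lemma card_le_of_separated {ι : Type*} (T : Finset ι) (pt : ι → ℝ) {u Λ δ : ℝ} (hδ : 0 < δ)
    (hΛ : 0 ≤ Λ) (hmem : ∀ i ∈ T, pt i ∈ Icc u (u + Λ))
    (hsep : ∀ i ∈ T, ∀ j ∈ T, i ≠ j → δ ≤ |pt i - pt j|) : (T.card : ℝ) ≤ Λ / δ + 1 := by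
  have h1 : T.card ≤ (Finset.range (⌊Λ / δ⌋₊ + 1)).card := by
    refine Finset.card_le_card_of_injOn (fun i => ⌊(pt i - u) / δ⌋₊) (fun i hi => ?_) ?_
    · rw [Finset.coe_range, mem_Iio, Nat.lt_succ_iff]
      refine Nat.floor_le_floor ?_
      gcongr
      linarith [(hmem i hi).2]
    · intro i hi j hj hij
      by_contra hne
      have h0 : ∀ k ∈ T, 0 ≤ (pt k - u) / δ := fun k hk =>
        div_nonneg (sub_nonneg.2 (hmem k hk).1) hδ.le
      have h2 := hsep i hi j hj hne
      have hij' : (⌊(pt i - u) / δ⌋₊ : ℝ) = ⌊(pt j - u) / δ⌋₊ := by exact_mod_cast hij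
      have h3 := Nat.floor_le (h0 i hi)
      have h4 := Nat.lt_floor_add_one ((pt i - u) / δ)
      have h5 := Nat.floor_le (h0 j hj)
      have h6 := Nat.lt_floor_add_one ((pt j - u) / δ)
      have h7 : |(pt i - u) / δ - (pt j - u) / δ| < 1 := by
        rw [abs_lt]; constructor <;> linarith
      rw [← sub_div, abs_div, abs_of_pos hδ, div_lt_one hδ] at h7
      rw [show pt i - u - (pt j - u) = pt i - pt j by ring] at h7
      linarith
  rw [Finset.card_range] at h1
  calc (T.card : ℝ) ≤ (⌊Λ / δ⌋₊ : ℝ) + 1 := by exact_mod_cast h1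
    _ ≤ _ := by gcongr; exact Nat.floor_le (by positivity)

/-- `c` is the first time at level `v` or above, and `b` the last time before `c` at level `u` or
below. -/
lemma exists_crossing {q : ℝ → ℝ} (hq : ContinuousOn q (Icc 0 1)) {u v : ℝ} (h0 : q 0 ≤ u)
    (huv : u < v) (h1 : v ≤ q 1) : ∃ b c, 0 ≤ b ∧ b < c ∧ c ≤ 1 ∧ q b = u ∧ q c = v ∧
      ∀ t ∈ Ioo b c, q t ∈ Ioo u v := by
  obtain ⟨c, ⟨hc, hcv⟩, hcl⟩ : ∃ c, IsLeast (Icc 0 1 ∩ q ⁻¹' Ici v) c :=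
    (isCompact_Icc.of_isClosed_subset (hq.preimage_isClosed_of_isClosed isClosed_Icc isClosed_Ici)
      inter_subset_left).exists_isLeast ⟨1, ⟨zero_le_one, le_rfl⟩, h1⟩
  have hqc : ContinuousOn q (Icc 0 c) := hq.mono (Icc_subset_Icc_right hc.2)
  have hlt : ∀ t ∈ Ico 0 c, q t < v := fun t ht => by
    by_contra! h
    exact absurd (hcl ⟨⟨ht.1, ht.2.le.trans hc.2⟩, h⟩) (not_le.2 ht.2)
  have hcv' : q c = v := by
    obtain ⟨t, ht, htv⟩ := intermediate_value_Icc hc.1 hqc ⟨h0.trans huv.le, hcv⟩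
    rcases ht.2.eq_or_lt with rfl | h
    · exact htv
    · exact absurd htv (hlt t ⟨ht.1, h⟩).ne
  obtain ⟨b, ⟨hb, hbu⟩, hbg⟩ : ∃ b, IsGreatest (Icc 0 c ∩ q ⁻¹' Iic u) b :=
    (isCompact_Icc.of_isClosed_subset (hqc.preimage_isClosed_of_isClosed isClosed_Icc isClosed_Iic)
      inter_subset_left).exists_isGreatest ⟨0, ⟨le_rfl, hc.1⟩, h0⟩
  have hbc : b < c := lt_of_le_of_ne hb.2 (by
    rintro rfl
    rw [mem_preimage, hcv', mem_Iic] at hbu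
    linarith)
  have hgt : ∀ t ∈ Ioc b c, u < q t := fun t ht => by
    by_contra! h
    exact absurd (hbg ⟨⟨hb.1.trans ht.1.le, ht.2⟩, h⟩) (not_le.2 ht.1)
  have hbu' : q b = u := by
    obtain ⟨t, ht, htu⟩ := intermediate_value_Icc hbc.le (hqc.mono (Icc_subset_Icc_left hb.1))
      ⟨hbu, by rw [hcv']; exact huv.le⟩
    rcases ht.1.eq_or_lt with rfl | h
    · exact htu
    · exact absurd htu (hgt t ⟨h, ht.2⟩).ne'
  exact ⟨b, c, hb.1, hbc, hc.2, hbu', hcv', fun t ht =>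
    ⟨hgt t ⟨ht.1, ht.2.le⟩, hlt t ⟨hb.1.trans ht.1.le, ht.2⟩⟩⟩

/-- A path through `n` separated values has a short piece which connects two of the values and
which avoids at least three quarters of a family of small sets of values. -/
lemma exists_short_crossing {ι : Type*} (S : Finset ι) (pt : ι → ℝ) {q : ℝ → ℝ}
    (hq : ContinuousOn q (Icc 0 1)) {δ Λ : ℝ} (hδ : 0 < δ) (hΛ : 0 ≤ Λ)
    (hsep : ∀ i ∈ S, ∀ j ∈ S, i ≠ j → δ ≤ |pt i - pt j|)
    (h0 : ∀ i ∈ S, q 0 ≤ pt i) {i₁ : ι} (hi₁ : i₁ ∈ S) (h1 : q 1 = pt i₁)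
    (hmax : ∀ i ∈ S, pt i ≤ pt i₁) (hn : 8 * (Λ / δ + 2) ≤ S.card)
    (G : Finset ℕ) (bad : ℕ → Set ℝ)
    (hbad : ∀ ℓ ∈ G, ∀ t ∈ Ioo (0 : ℝ) 1 ∩ bad ℓ, ∀ t' ∈ Ioo (0 : ℝ) 1 ∩ bad ℓ, |q t - q t'| ≤ Λ) :
    ∃ i ∈ S, ∃ j ∈ S, i ≠ j ∧ ∃ b c, 0 ≤ b ∧ b < c ∧ c ≤ 1 ∧ q b = pt i ∧ q c = pt j ∧
      c - b ≤ 4 / S.card ∧ ∃ G' ⊆ G, 3 / 4 * (G.card : ℝ) ≤ G'.card ∧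
        ∀ ℓ ∈ G', ∀ t ∈ Ioo b c, t ∉ bad ℓ := by
  classical
  have hΛδ : 0 ≤ Λ / δ := by positivity
  have hn16 : (16 : ℝ) ≤ S.card := by linarith
  set S' := S.erase i₁ with hS'
  have hlt : ∀ i ∈ S', pt i < pt i₁ := fun i hi => by
    obtain ⟨hne, hiS⟩ := Finset.mem_erase.1 hi
    have h2 := hsep i hiS i₁ hi₁ hne
    have h3 := hmax i hiS
    rw [abs_of_nonpos (by linarith)] at h2
    linarith
  have hnext : ∀ i ∈ S', ∃ j ∈ S, pt i < pt j ∧ ∀ k ∈ S, pt i < pt k → pt j ≤ pt k := fun i hi => by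
    obtain ⟨j, hj, hjm⟩ := Finset.exists_min_image (S.filter fun k => pt i < pt k) pt
      ⟨i₁, Finset.mem_filter.2 ⟨hi₁, hlt i hi⟩⟩
    rw [Finset.mem_filter] at hj
    exact ⟨j, hj.1, hj.2, fun k hk hik => hjm k (Finset.mem_filter.2 ⟨hk, hik⟩)⟩
  choose! nx hnxS hnxlt hnxle using hnext
  have hsub : S' ⊆ S := Finset.erase_subset _ _
  have hinj : ∀ i ∈ S', ∀ j ∈ S', i ≠ j → pt i ≠ pt j := fun i hi j hj hij h => by
    have := hsep i (hsub hi) j (hsub hj) hij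
    rw [h, sub_self, abs_zero] at this
    linarith
  -- The times spent in the gap between `pt i` and the next larger value. These sets are disjoint
  -- for different `i`, so their lengths sum to at most `1`.
  set E : ι → Set ℝ := fun i => Ioo 0 1 ∩ q ⁻¹' Ioo (pt i) (pt (nx i)) with hE
  have hEo : ∀ i, IsOpen (E i) := fun i =>
    (hq.mono Ioo_subset_Icc_self).isOpen_inter_preimage isOpen_Ioo isOpen_Ioo
  have hEfin : ∀ i, volume (E i) ≠ ⊤ := fun i =>
    ((measure_mono inter_subset_left).trans_lt (by simp)).ne
  have hEdisj : (S' : Set ι).PairwiseDisjoint E := by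
    intro i hi j hj hij
    rw [Function.onFun, Set.disjoint_left]
    rintro t ⟨_, hti⟩ ⟨_, htj⟩
    rcases lt_or_gt_of_ne (hinj i hi j hj hij) with h | h
    · have := hnxle i hi j (hsub hj) h
      linarith [hti.2, htj.1]
    · have := hnxle j hj i (hsub hi) h
      linarith [hti.1, htj.2]
  have hEsum : ∑ i ∈ S', volume.real (E i) ≤ 1 := by
    rw [← measureReal_biUnion_finset hEdisj (fun i _ => (hEo i).measurableSet) fun i _ => hEfin i]
    calc _ ≤ volume.real (Ioo (0 : ℝ) 1) :=
          measureReal_mono (iUnion₂_subset fun i _ => inter_subset_left) (by simp)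
      _ = 1 := by simp
  set n : ℝ := (S.card : ℝ) with hn_def
  have hcardS' : (S'.card : ℝ) = n - 1 := by
    rw [hS', Finset.card_erase_of_mem hi₁, Nat.cast_sub (Finset.card_pos.2 ⟨i₁, hi₁⟩), Nat.cast_one]
  set S'' := S'.filter fun i => volume.real (E i) ≤ 4 / n with hS''
  -- At most `n / 4` gaps can last longer than `4 / n`, out of `n - 1`.
  have hcardS'' : n / 2 ≤ S''.card := by
    have h2 : (S''.card : ℝ) + (S'.filter fun i => ¬ volume.real (E i) ≤ 4 / n).card = n - 1 := by
      rw [← hcardS', ← Finset.card_filter_add_card_filter_not (s := S')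
        fun i => volume.real (E i) ≤ 4 / n]
      push_cast; rfl
    have h3 : ((S'.filter fun i => ¬ volume.real (E i) ≤ 4 / n).card : ℝ) * (4 / n) ≤ 1 := by
      refine le_trans ?_ hEsum
      refine le_trans ?_ (Finset.sum_le_sum_of_subset_of_nonneg
        (Finset.filter_subset (fun i => ¬ volume.real (E i) ≤ 4 / n) S')
        fun i _ _ => measureReal_nonneg)
      rw [← nsmul_eq_mul]
      exact Finset.card_nsmul_le_sum _ _ _ fun i hi => (not_le.1 (Finset.mem_filter.1 hi).2).le
    rw [mul_div_assoc', div_le_one (by linarith)] at h3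
    linarith
  set R : ι → ℕ → Prop := fun i ℓ => ∃ t ∈ E i, t ∈ bad ℓ with hR
  have hcount : ∀ ℓ ∈ G, ((S''.filter fun i => R i ℓ).card : ℝ) ≤ n / 8 := fun ℓ hℓ => by
    set T := S''.filter fun i => R i ℓ with hT
    have hTS : ∀ i ∈ T, i ∈ S' := fun i hi =>
      (Finset.mem_filter.1 (Finset.mem_filter.1 hi).1).1
    have hTR : ∀ i ∈ T, R i ℓ := fun i hi => (Finset.mem_filter.1 hi).2
    choose! y hyE hybad using hTR
    rcases T.eq_empty_or_nonempty with h | h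
    · rw [h, Finset.card_empty, Nat.cast_zero]; linarith
    -- With `m` the lowest gap containing a bad time, every other such gap `i` has `q (y m) < pt (nx
    -- m) ≤ pt i < q (y i) ≤ q (y m) + Λ`. The remaining `pt i` are thus separated points of a
    -- window of length `Λ`.
    · obtain ⟨m, hm, hmin⟩ := Finset.exists_min_image T pt h
      have h2 : ((T.erase m).card : ℝ) ≤ Λ / δ + 1 := by
        refine card_le_of_separated (T.erase m) pt (u := q (y m)) hδ hΛ (fun i hi => ?_)
          fun i hi j hj hij => hsep i (hsub (hTS i (Finset.mem_of_mem_erase hi))) j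
            (hsub (hTS j (Finset.mem_of_mem_erase hj))) hij
        obtain ⟨hne, hiT⟩ := Finset.mem_erase.1 hi
        have h3 : pt m < pt i := lt_of_le_of_ne (hmin i hiT) (hinj m (hTS m hm) i (hTS i hiT) hne.symm)
        have h4 := hnxle m (hTS m hm) i (hsub (hTS i hiT)) h3
        have h5 := (hyE m hm).2.2
        have h6 := (hyE i hiT).2.1
        have h7 := hbad ℓ hℓ (y i) ⟨(hyE i hiT).1, hybad i hiT⟩ (y m) ⟨(hyE m hm).1, hybad m hm⟩
        have h8 := (abs_le.1 h7).2
        constructor <;> linarith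
      rw [Finset.card_erase_of_mem hm, Nat.cast_sub (Finset.card_pos.2 ⟨m, hm⟩), Nat.cast_one] at h2
      linarith
  obtain ⟨i, hi, hib⟩ : ∃ i ∈ S'', ((G.filter fun ℓ => R i ℓ).card : ℝ) ≤ G.card / 4 := by
    -- Double counting of the pairs of a short gap and a layer bad in it: at most `n / 8` per layer,
    -- against more than a quarter of `G` for each of at least `n / 2` gaps.
    by_contra! hcon
    have h2 : ∑ i ∈ S'', ((G.filter fun ℓ => R i ℓ).card : ℝ) =
        ∑ ℓ ∈ G, ((S''.filter fun i => R i ℓ).card : ℝ) := by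
      exact_mod_cast Finset.sum_card_bipartiteAbove_eq_sum_card_bipartiteBelow (s := S'') (t := G) R
    have h3 := Finset.sum_le_sum hcount
    rw [← h2, Finset.sum_const, nsmul_eq_mul] at h3
    have hne : S''.Nonempty := by
      rw [← Finset.card_pos]
      have : (0 : ℝ) < S''.card := by linarith
      exact_mod_cast this
    have h4 := Finset.sum_lt_sum_of_nonempty hne hcon
    rw [Finset.sum_const, nsmul_eq_mul] at h4
    have h5 : n / 2 * (G.card / 4) ≤ S''.card * ((G.card : ℝ) / 4) := by gcongr
    nlinarith
  obtain ⟨hiS', hiE⟩ := Finset.mem_filter.1 hi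
  obtain ⟨b, c, hb0, hbc, hc1, hqb, hqc, hcross⟩ := exists_crossing hq (h0 i (hsub hiS'))
    (hnxlt i hiS') (h1 ▸ hmax _ (hnxS i hiS'))
  have hIoo : Ioo b c ⊆ E i := fun t ht => ⟨⟨hb0.trans_lt ht.1, ht.2.trans_le hc1⟩, hcross t ht⟩
  refine ⟨i, hsub hiS', nx i, hnxS i hiS', fun h => (hnxlt i hiS').ne (congrArg pt h), b, c, hb0,
    hbc, hc1, hqb, hqc, ?_, G.filter fun ℓ => ¬ R i ℓ, Finset.filter_subset _ _, ?_, ?_⟩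
  · refine le_trans ?_ hiE
    have := measureReal_mono hIoo (hEfin i)
    rwa [Real.volume_real_Ioo_of_le hbc.le] at this
  · have h2 : ((G.filter fun ℓ => R i ℓ).card : ℝ) + (G.filter fun ℓ => ¬ R i ℓ).card = G.card := by
      exact_mod_cast Finset.card_filter_add_card_filter_not (s := G) fun ℓ => R i ℓ
    linarith
  · intro ℓ hℓ t ht htb
    exact (Finset.mem_filter.1 hℓ).2 ⟨t, hIoo ht, htb⟩

/-! ### The deterministic lower bound on the tangent kernel -/

lemma euclNorm_sub_le {n : ℕ} (v w : Fin n → ℝ) : euclNorm (v - w) ≤ euclNorm v + euclNorm w := by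
  simpa [euclNorm] using norm_sub_le (WithLp.toLp 2 v : EuclideanSpace ℝ (Fin n)) (WithLp.toLp 2 w)

/-- Any two points of `K` are joined inside `K` by a differentiable curve of speed at most `V`. -/
def HasBoundedPaths {E : Type*} [NormedAddCommGroup E] [NormedSpace ℝ E] (K : Set E) (V : ℝ) :
    Prop :=
  ∀ x ∈ K, ∀ y ∈ K, ∃ γ γ' : ℝ → E, γ 0 = x ∧ γ 1 = y ∧
    ∀ t ∈ Icc (0 : ℝ) 1, HasDerivAt γ (γ' t) t ∧ ‖γ' t‖ ≤ V ∧ γ t ∈ K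

namespace NetParams

variable {L din dout : ℕ} (θ : NetParams L din dout) {a s : ℝ}

/-- The squared norms sum to at most `2 L`, so at most `L / 4` layers exceed `8`, while at least `L
/ 2` layers are considered. -/
lemma card_filter_fro_sq_le {C : ℝ} (hC : θ.normSq ≤ L + C) (hCL : C ≤ L) (hL : 0 < L) :
    (L : ℝ) / 4 ≤ ((Finset.range (L / 2 + 1)).filter fun ℓ => θ.fro ℓ ^ 2 ≤ 8).card := by
  have h1 : (((Finset.range (L / 2 + 1)).filter fun ℓ => θ.fro ℓ ^ 2 ≤ 8).card : ℝ) +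
      ((Finset.range (L / 2 + 1)).filter fun ℓ => ¬ θ.fro ℓ ^ 2 ≤ 8).card = (L / 2 : ℕ) + 1 := by
    have := Finset.card_filter_add_card_filter_not (s := Finset.range (L / 2 + 1))
      fun ℓ => θ.fro ℓ ^ 2 ≤ 8
    rw [Finset.card_range] at this
    exact_mod_cast this
  have h2 : (((Finset.range (L / 2 + 1)).filter fun ℓ => ¬ θ.fro ℓ ^ 2 ≤ 8).card : ℝ) * 8 ≤
      L + C := by
    rw [← nsmul_eq_mul]
    refine (Finset.card_nsmul_le_sum _ (fun ℓ => θ.fro ℓ ^ 2) _ fun ℓ hℓ =>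
      (not_le.1 (Finset.mem_filter.1 hℓ).2).le).trans (le_trans ?_
        (θ.sum_frobSq_le_normSq.trans hC))
    refine Finset.sum_le_sum_of_subset_of_nonneg (fun ℓ hℓ => ?_) fun _ _ _ => sq_nonneg _
    have := Finset.mem_range.1 (Finset.mem_filter.1 hℓ).1
    exact Finset.mem_range.2 (by omega)
  have h3 : (L : ℝ) / 2 ≤ (L / 2 : ℕ) + 1 := by
    have : L ≤ 2 * (L / 2 + 1) := by omega
    have : (L : ℝ) ≤ 2 * ((L / 2 : ℕ) + 1) := by exact_mod_cast this
    linarith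
  linarith

/-- A network of almost minimal norm whose values at `n` points are separated by `r` has a large
tangent kernel. -/
lemma exists_le_trace_ntk (ha : |a| ≤ 1) (hs : |s| ≤ 1) {K : Set (EuclideanSpace ℝ (Fin din))}
    {V D r C c : ℝ} (hV : 0 < V) (hr : 0 < r) (hK : HasBoundedPaths K V)
    (hD : ∀ x ∈ K, ∀ y ∈ K, ‖x - y‖ ≤ D) (hc : θ.normSq = L + c) (hcC : c ≤ C) (hCL : C ≤ L)
    (hL : 0 < L)
    (hLbig : 2 * Real.exp (C + 1) * |C + 2 * Real.log (D / r)| * D ^ 2 ≤ (r / 8) ^ 2 * L)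
    {ι : Type*} (S : Finset ι) (hS : 64 ≤ S.card) (X : ι → EuclideanSpace ℝ (Fin din))
    (hXK : ∀ i ∈ S, X i ∈ K)
    (hX : ∀ i ∈ S, ∀ j ∈ S, i ≠ j → r ≤ ‖θ.out a (X i) - θ.out a (X j)‖) :
    ∃ x ∈ K, (L : ℝ) * Real.exp (-c) * (S.card * r) ^ 4 / (2 ^ 28 * V ^ 2) ≤
      (θ.ntk a s x x).trace := by
  classical
  have hLpos : (0 : ℝ) < L := by exact_mod_cast hL
  have hn : (64 : ℝ) ≤ S.card := by exact_mod_cast hS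
  obtain ⟨i₂, hi₂, i₃, hi₃, hi₂₃⟩ := Finset.one_lt_card.1 (by omega : 1 < S.card)
  have hML : L / 2 < L := by omega
  -- The nearly rank-one layer is sought from `L / 2` on, so that `p` is controlled by every layer
  -- of the first half. The error `r / 8` leaves the values of `p` at least `r / 2` apart.
  obtain ⟨p, hpc, hpout, hpact⟩ := θ.exists_scalar_coordinate ha hr
    (hD _ (hXK i₂ hi₂) _ (hXK i₃ hi₃)) (hX i₂ hi₂ i₃ hi₃ hi₂₃) hc hML (ε := r / 8) (by positivity)
    (by
      have h1 : (L : ℝ) / 2 ≤ L - (L / 2 : ℕ) := by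
        have : (2 : ℝ) * (L / 2 : ℕ) ≤ L := by exact_mod_cast (by omega : 2 * (L / 2) ≤ L)
        linarith
      have h2 : (c + 2 * Real.log (D / r)) / (L - (L / 2 : ℕ)) ≤
          |C + 2 * Real.log (D / r)| / (L / 2) := by
        refine (div_le_div_of_nonneg_right ?_ (by linarith)).trans
          (div_le_div_of_nonneg_left (abs_nonneg _) (by positivity) h1)
        exact le_trans (by linarith) (le_abs_self _)
      calc _ ≤ Real.exp (c + 1) * (|C + 2 * Real.log (D / r)| / (L / 2)) * D ^ 2 := by gcongr
        _ ≤ Real.exp (C + 1) * (|C + 2 * Real.log (D / r)| / (L / 2)) * D ^ 2 := by gcongr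
        _ = 2 * Real.exp (C + 1) * |C + 2 * Real.log (D / r)| * D ^ 2 / L := by field_simp
        _ ≤ _ := by rwa [div_le_iff₀ hLpos])
  have hsep : ∀ i ∈ S, ∀ j ∈ S, i ≠ j → r / 2 ≤ |p (X i) - p (X j)| := fun i hi j hj hij => by
    have h1 := hX i hi j hj hij
    have h2 := hpout _ _ (hD _ (hXK i hi) _ (hXK j hj))
    linarith
  have hBpos : ∀ ℓ ≤ L / 2, 0 < θ.froProd ℓ L := fun ℓ hℓ => by
    have h1 := hpact ℓ hℓ (X i₂) (X i₃)
    have h2 := hsep i₂ hi₂ i₃ hi₃ hi₂₃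
    exact pos_of_mul_pos_left (by linarith) (euclNorm_nonneg _)
  obtain ⟨i₀, hi₀, hmin⟩ := Finset.exists_min_image S (fun i => p (X i)) ⟨i₂, hi₂⟩
  obtain ⟨i₁, hi₁, hmax⟩ := Finset.exists_max_image S (fun i => p (X i)) ⟨i₂, hi₂⟩
  obtain ⟨γ, γ', hγ0, hγ1, hγ⟩ := hK _ (hXK i₀ hi₀) _ (hXK i₁ hi₁)
  have hγc : ContinuousOn γ (Icc 0 1) := fun t ht => (hγ t ht).1.continuousAt.continuousWithinAt
  set G := (Finset.range (L / 2 + 1)).filter fun ℓ => θ.fro ℓ ^ 2 ≤ 8 with hG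
  have hGle : ∀ ℓ ∈ G, ℓ ≤ L / 2 := fun ℓ hℓ => by
    have := Finset.mem_range.1 (Finset.mem_filter.1 hℓ).1; omega
  -- Two times with activation norm at most `ρ ℓ` have values of `p` within `2 * ρ ℓ * froProd ℓ L =
  -- S.card * r / 64`, the window `Λ` below.
  set ρ : ℕ → ℝ := fun ℓ => S.card * r / (128 * θ.froProd ℓ L) with hρ
  obtain ⟨i, hi, j, hj, hij, b, c', hb0, hbc, hc1, hqb, hqc, hlen, G', hG'G, hG'card, hG'⟩ :=
    exists_short_crossing S (fun i => p (X i)) (q := fun t => p (γ t)) (hpc.comp_continuousOn hγc)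
      (δ := r / 2) (Λ := S.card * r / 64) (by positivity) (by positivity) hsep
      (by rw [hγ0]; exact hmin) hi₁ (by rw [hγ1]) hmax
      (by
        have : (S.card * r / 64 : ℝ) / (r / 2) = S.card / 32 := by field_simp; norm_num
        rw [this]; linarith) G
      (fun ℓ => {t | euclNorm (θ.act a (γ t) ℓ) ≤ ρ ℓ})
      (by
        rintro ℓ hℓ t ⟨-, ht⟩ t' ⟨-, ht'⟩
        refine (hpact ℓ (hGle ℓ hℓ) _ _).trans ?_
        have hB := hBpos ℓ (hGle ℓ hℓ)
        calc _ ≤ θ.froProd ℓ L * (ρ ℓ + ρ ℓ) := by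
              gcongr
              exact (euclNorm_sub_le _ _).trans (add_le_add ht ht')
          _ = _ := by simp only [hρ]; field_simp; norm_num)
  have hsubI : Icc b c' ⊆ Icc 0 1 := Icc_subset_Icc hb0 hc1
  -- The ends of the piece need not be sample points, but `p` agrees there with `X i` and `X j`;
  -- hence the outputs move by at least `r - 2 * (r / 8)`, while the assumed speed over time `4 /
  -- S.card` allows only `r / 4`.
  obtain ⟨t, ht, htan⟩ := θ.exists_lt_euclNorm_tanPreact ha s (γ := γ) (γ' := γ')
    (K := S.card * r / 16) hbc.le (fun t ht => (hγ t (hsubI ht)).1) (by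
      have h1 := hX i hi j hj hij
      have hbK := (hγ b (hsubI ⟨le_rfl, hbc.le⟩)).2.2
      have hcK := (hγ c' (hsubI ⟨hbc.le, le_rfl⟩)).2.2
      have h2 := hpout _ _ (hD _ (hXK i hi) _ hbK)
      have h3 := hpout _ _ (hD _ hcK _ (hXK j hj))
      rw [hqb, sub_self, abs_zero] at h2
      rw [hqc, sub_self, abs_zero] at h3
      have h4 : ‖θ.out a (X i) - θ.out a (X j)‖ ≤ ‖θ.out a (X i) - θ.out a (γ b)‖ +
          ‖θ.out a (γ c') - θ.out a (γ b)‖ + ‖θ.out a (γ c') - θ.out a (X j)‖ := by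
        rw [norm_sub_rev (θ.out a (γ c')) (θ.out a (γ b))]
        exact (norm_sub_le_norm_sub_add_norm_sub _ (θ.out a (γ c')) _).trans
          (add_le_add_left (norm_sub_le_norm_sub_add_norm_sub _ _ _) _)
      have h5 : S.card * r / 16 * (c' - b) ≤ S.card * r / 16 * (4 / S.card) := by gcongr
      have h6 : S.card * r / 16 * (4 / S.card) = r / 4 := by field_simp; norm_num
      linarith)
  have htI : t ∈ Icc (0 : ℝ) 1 := hsubI (Ioo_subset_Icc_self ht)
  refine ⟨γ t, (hγ t htI).2.2, ?_⟩
  set w : Fin (θ.width 0) → ℝ := fun i => γ' t (Fin.cast θ.width_zero i) with hw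
  have hwV : euclNorm w ≤ V := by
    rw [hw, euclNorm_comp_cast]; exact (hγ t htI).2.1
  have h0pos : ∀ ℓ ≤ L / 2, 0 < θ.froProd 0 (ℓ + 1) := fun ℓ hℓ => by
    have h1 := hBpos 0 (Nat.zero_le _)
    rw [← θ.froProd_mul (Nat.zero_le (ℓ + 1)) (by omega : ℓ + 1 ≤ L)] at h1
    exact pos_of_mul_pos_left h1 (θ.froProd_nonneg _ _)
  -- `2 ^ 25 = 128² * 16² * 8`: the threshold `ρ`, the speed, and `fro ℓ ^ 2 ≤ 8`. The last is
  -- needed because `froProd 0 (ℓ + 1)` and `froProd ℓ L` both contain the factor `fro ℓ`.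
  have hmain := θ.card_mul_le_trace_ntk (s := s) (a := a) (γ t) w
    (q := Real.exp (-c) * (S.card * r) ^ 4 / (2 ^ 25 * V ^ 2))
    (fun ℓ => θ.froProd 0 (ℓ + 1) * V) G'
    (fun ℓ hℓ => Finset.mem_range.2 ((hGle ℓ (hG'G hℓ)).trans_lt hML))
    (fun ℓ hℓ => mul_pos (h0pos ℓ (hGle ℓ (hG'G hℓ))) hV)
    (fun ℓ _ => (θ.euclNorm_tanPreact_succ_le (γ t) ha hs w ℓ).trans
      (mul_le_mul_of_nonneg_left hwV (θ.froProd_nonneg _ _)))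
    (fun ℓ hℓ => by
      have hℓM := hGle ℓ (hG'G hℓ)
      have hB := hBpos ℓ hℓM
      have hfro : θ.fro ℓ ^ 2 ≤ 8 := (Finset.mem_filter.1 (hG'G hℓ)).2
      have h1 : ρ ℓ ≤ euclNorm (θ.act a (γ t) ℓ) := (not_le.1 (hG' ℓ hℓ t ht)).le
      have h2 : (θ.froProd 0 ℓ * θ.froProd ℓ L) ^ 2 ≤ Real.exp c := by
        rw [θ.froProd_mul (Nat.zero_le ℓ) (by omega)]
        exact θ.froProd_sq_le_exp hc
      have h3 : Real.exp (-c) * θ.froProd 0 ℓ ^ 2 ≤ 1 / θ.froProd ℓ L ^ 2 := by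
        rw [le_div_iff₀ (by positivity), Real.exp_neg, mul_assoc, ← mul_pow,
          inv_mul_le_iff₀ (Real.exp_pos c), mul_one]
        exact h2
      calc Real.exp (-c) * (S.card * r) ^ 4 / (2 ^ 25 * V ^ 2) * (θ.froProd 0 (ℓ + 1) * V) ^ 2
          = (S.card * r) ^ 4 / 2 ^ 25 * (Real.exp (-c) * θ.froProd 0 ℓ ^ 2) * θ.fro ℓ ^ 2 := by
            rw [θ.froProd_succ (Nat.zero_le ℓ)]; field_simp
        _ ≤ (S.card * r) ^ 4 / 2 ^ 25 * (1 / θ.froProd ℓ L ^ 2) * 8 := by gcongr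
        _ = ρ ℓ ^ 2 * (S.card * r / 16) ^ 2 := by simp only [hρ]; field_simp; norm_num
        _ ≤ _ := by gcongr)
  refine le_trans ?_ hmain
  have hcard : (L : ℝ) / 8 ≤ G'.card := by
    have := θ.card_filter_fro_sq_le (C := C) (by rw [hc]; linarith) hCL hL
    rw [← hG] at this
    linarith
  calc (L : ℝ) * Real.exp (-c) * (S.card * r) ^ 4 / (2 ^ 28 * V ^ 2)
      = L / 8 * (Real.exp (-c) * (S.card * r) ^ 4 / (2 ^ 25 * V ^ 2)) := by field_simp; norm_num
    _ ≤ _ := by gcongr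

end NetParams

/-! ### Separated subsets of random samples -/

section Sampling

variable {E F : Type*}

/-- The samples `X` of size `N` containing `n` points of `K` whose images under `Y` are `r`-separated
from each other and from the points of `T`. -/
def separatedSamples [PseudoMetricSpace F] (K : Set E) (Y : E → F) (r : ℝ) (N : ℕ) (T : Finset F)
    (n : ℕ) : Set (Fin N → E) :=
  {X | ∃ S : Finset (Fin N), n ≤ S.card ∧ (∀ i ∈ S, X i ∈ K ∧ ∀ y ∈ T, r ≤ dist (Y (X i)) y) ∧
    ∀ i ∈ S, ∀ j ∈ S, i ≠ j → r ≤ dist (Y (X i)) (Y (X j))}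

lemma mem_separatedSamples_zero [PseudoMetricSpace F] (K : Set E) (Y : E → F) (r : ℝ) {N : ℕ}
    (T : Finset F) (X : Fin N → E) : X ∈ separatedSamples K Y r N T 0 :=
  ⟨∅, by simp⟩

lemma cons_mem_separatedSamples [PseudoMetricSpace F] {K : Set E} {Y : E → F} {r : ℝ} {N n : ℕ}
    {T : Finset F} (x : E) {X : Fin N → E} (h : X ∈ separatedSamples K Y r N T n) :
    (Fin.cons x X : Fin (N + 1) → E) ∈ separatedSamples K Y r (N + 1) T n := by
  obtain ⟨S, hS, hSK, hSs⟩ := h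
  refine ⟨S.map (Fin.succEmb N), by simpa using hS, ?_, ?_⟩
  · simpa using hSK
  · simpa using hSs

lemma cons_mem_separatedSamples_succ [PseudoMetricSpace F] [DecidableEq F] {K : Set E} {Y : E → F}
    {r : ℝ} {N n : ℕ} {T : Finset F} {x : E} (hx : x ∈ K) (hxT : ∀ y ∈ T, r ≤ dist (Y x) y)
    {X : Fin N → E} (h : X ∈ separatedSamples K Y r N (insert (Y x) T) n) :
    (Fin.cons x X : Fin (N + 1) → E) ∈ separatedSamples K Y r (N + 1) T (n + 1) := by
  obtain ⟨S, hS, hSK, hSs⟩ := h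
  have h0 : (0 : Fin (N + 1)) ∉ S.map (Fin.succEmb N) := by simp [Fin.succ_ne_zero]
  refine ⟨Finset.cons 0 (S.map (Fin.succEmb N)) h0, by simpa using hS, ?_, ?_⟩
  · simp only [Finset.mem_cons, forall_eq_or_imp, Fin.cons_zero]
    refine ⟨⟨hx, hxT⟩, ?_⟩
    simp only [Finset.mem_map, Fin.coe_succEmb, forall_exists_index, and_imp,
      forall_apply_eq_imp_iff₂, Fin.cons_succ]
    exact fun i hi => ⟨(hSK i hi).1, fun y hy => (hSK i hi).2 y (Finset.mem_insert_of_mem hy)⟩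
  · have h1 : ∀ i ∈ S, r ≤ dist (Y (X i)) (Y x) := fun i hi =>
      (hSK i hi).2 _ (Finset.mem_insert_self _ _)
    simp only [Finset.mem_cons, Finset.mem_map, Fin.coe_succEmb]
    rintro i (rfl | ⟨i, hi, rfl⟩) j (rfl | ⟨j, hj, rfl⟩) hij
    · exact absurd rfl hij
    · rw [dist_comm]; simpa using h1 j hj
    · simpa using h1 i hi
    · simpa using hSs i hi j hj fun h => hij (congrArg _ h)

variable [MeasurableSpace E] [PseudoMetricSpace F] [SecondCountableTopology F]
  [MeasurableSpace F] [OpensMeasurableSpace F]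

lemma measurableSet_separatedSamples {K : Set E} (hK : MeasurableSet K) {Y : E → F}
    (hY : Measurable Y) (r : ℝ) (N : ℕ) (T : Finset F) (n : ℕ) :
    MeasurableSet (separatedSamples K Y r N T n) := by
  have hYi : ∀ i : Fin N, Measurable fun X : Fin N → E => Y (X i) := fun i =>
    hY.comp (measurable_pi_apply i)
  have h1 : ∀ i : Fin N, MeasurableSet
      {X : Fin N → E | X i ∈ K ∧ ∀ y ∈ T, r ≤ dist (Y (X i)) y} := fun i => by
    have : {X : Fin N → E | X i ∈ K ∧ ∀ y ∈ T, r ≤ dist (Y (X i)) y} =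
        (fun X => X i) ⁻¹' K ∩ ⋂ y ∈ T, {X | r ≤ dist (Y (X i)) y} := by ext; simp
    rw [this]
    exact (measurable_pi_apply i hK).inter (Finset.measurableSet_biInter _ fun y _ =>
      measurableSet_le measurable_const ((hYi i).dist measurable_const))
  have h2 : ∀ i j : Fin N, MeasurableSet {X : Fin N → E | r ≤ dist (Y (X i)) (Y (X j))} :=
    fun i j => measurableSet_le measurable_const ((hYi i).dist (hYi j))
  have : separatedSamples K Y r N T n = ⋃ S : Finset (Fin N), ⋃ _ : n ≤ S.card,
      (⋂ i ∈ S, {X : Fin N → E | X i ∈ K ∧ ∀ y ∈ T, r ≤ dist (Y (X i)) y}) ∩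
      ⋂ i ∈ S, ⋂ j ∈ S, ⋂ _ : i ≠ j, {X : Fin N → E | r ≤ dist (Y (X i)) (Y (X j))} := by
    ext X; simp [separatedSamples, and_left_comm]
  rw [this]
  exact MeasurableSet.iUnion fun S => MeasurableSet.iUnion fun _ =>
    (Finset.measurableSet_biInter _ fun i _ => h1 i).inter
      (Finset.measurableSet_biInter _ fun i _ => Finset.measurableSet_biInter _ fun j _ =>
        MeasurableSet.iInter fun _ => h2 i j)

/-- A random sample contains many separated points with high probability. -/
lemma measure_compl_separatedSamples_le (μ : Measure E) [IsProbabilityMeasure μ] {K : Set E}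
    (hK : MeasurableSet K) {Y : E → F} (hY : Measurable Y) {r κ : ℝ} (hκ : 0 ≤ κ)
    (hball : ∀ y : F, μ.real (K ∩ {x | dist (Y x) y < r}) ≤ κ) (N : ℕ) :
    ∀ (T : Finset F) (n : ℕ), (T.card + n) * κ ≤ μ.real K / 2 →
      Measure.pi (fun _ : Fin N => μ) (separatedSamples K Y r N T n)ᶜ ≤
        ENNReal.ofReal (2 ^ n * (1 - μ.real K / 4) ^ N) := by
  classical
  have hK1 : μ.real K ≤ 1 := measureReal_le_one
  have hK0 : 0 ≤ μ.real K := measureReal_nonneg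
  induction N with
  | zero =>
    intro T n _
    refine prob_le_one.trans ?_
    rw [← ENNReal.ofReal_one, pow_zero, mul_one]
    exact ENNReal.ofReal_le_ofReal (one_le_pow₀ one_le_two)
  | succ N ih =>
    intro T n hn
    rcases n with _ | n
    · have : (separatedSamples K Y r (N + 1) T 0)ᶜ = ∅ := by
        ext X; simpa using mem_separatedSamples_zero K Y r T X
      rw [this]; simp
    set ν := Measure.pi fun _ : Fin N => μ
    -- The acceptable first samples. An accepted one is moved into `T` and lowers the quota `n` by
    -- one, so the bound on `T.card + n` persists.
    set A : Set E := K ∩ ⋂ y ∈ T, {x | r ≤ dist (Y x) y} with hA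
    have hAm : MeasurableSet A := hK.inter (Finset.measurableSet_biInter _ fun y _ =>
      measurableSet_le measurable_const (hY.dist measurable_const))
    have hAμ : μ.real K / 2 ≤ μ.real A := by
      have h1 : K ⊆ A ∪ ⋃ y ∈ T, K ∩ {x | dist (Y x) y < r} := by
        intro x hx
        by_cases h : ∀ y ∈ T, r ≤ dist (Y x) y
        · exact Or.inl ⟨hx, by simpa using h⟩
        · push Not at h
          obtain ⟨y, hy, hlt⟩ := h
          exact Or.inr (mem_biUnion hy ⟨hx, hlt⟩)
      have h2 : μ.real K ≤ μ.real A + T.card * κ := by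
        calc μ.real K ≤ μ.real (A ∪ ⋃ y ∈ T, K ∩ {x | dist (Y x) y < r}) := measureReal_mono h1
          _ ≤ μ.real A + μ.real (⋃ y ∈ T, K ∩ {x | dist (Y x) y < r}) := measureReal_union_le _ _
          _ ≤ μ.real A + ∑ y ∈ T, μ.real (K ∩ {x | dist (Y x) y < r}) := by
            gcongr; exact measureReal_biUnion_finset_le _ _
          _ ≤ μ.real A + T.card * κ := by
            gcongr
            rw [← nsmul_eq_mul]
            exact Finset.sum_le_card_nsmul _ _ _ fun y _ => hball y
      have h3 : (T.card : ℝ) * κ ≤ (T.card + (n + 1 : ℕ)) * κ := by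
        gcongr; exact le_add_of_nonneg_right (Nat.cast_nonneg _)
      linarith
    set e := (MeasurableEquiv.piFinSuccAbove (fun _ : Fin (N + 1) => E) 0).symm
    have hmp : MeasurePreserving e (μ.prod ν) (Measure.pi fun _ : Fin (N + 1) => μ) :=
      (measurePreserving_piFinSuccAbove (fun _ : Fin (N + 1) => μ) 0).symm
    have he : ∀ x X, e (x, X) = Fin.cons x X := fun x X => by
      simp [e, MeasurableEquiv.piFinSuccAbove]; rfl
    have hmeas := (measurableSet_separatedSamples hK hY r (N + 1) T (n + 1)).compl
    set c := 1 - μ.real K / 4 with hc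
    have hc0 : 0 ≤ c := by rw [hc]; linarith
    rw [← hmp.measure_preimage hmeas.nullMeasurableSet, Measure.prod_apply (e.measurable hmeas),
      ← lintegral_add_compl _ hAm]
    have hinA : ∀ x ∈ A, ν (Prod.mk x ⁻¹' (e ⁻¹' (separatedSamples K Y r (N + 1) T (n + 1))ᶜ)) ≤
        ENNReal.ofReal (2 ^ n * c ^ N) := fun x hx => by
      refine (measure_mono fun X hX hX' => ?_).trans (ih (insert (Y x) T) n ?_)
      · rw [mem_preimage, mem_preimage, he] at hX
        exact hX (cons_mem_separatedSamples_succ hx.1 (by simpa using hx.2) hX')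
      · refine le_trans (mul_le_mul_of_nonneg_right ?_ hκ) hn
        have : ((insert (Y x) T).card : ℝ) ≤ T.card + 1 := by
          exact_mod_cast Finset.card_insert_le _ _
        push_cast; linarith
    have hout : ∀ x, ν (Prod.mk x ⁻¹' (e ⁻¹' (separatedSamples K Y r (N + 1) T (n + 1))ᶜ)) ≤
        ENNReal.ofReal (2 ^ (n + 1) * c ^ N) := fun x => by
      refine (measure_mono fun X hX hX' => ?_).trans (ih T (n + 1) hn)
      rw [mem_preimage, mem_preimage, he] at hX
      exact hX (cons_mem_separatedSamples x hX')
    -- Acceptance halves the failure bound and has probability at least `μ.real K / 2`; averaging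
    -- gives the factor `1 - μ.real A / 2 ≤ c`.
    calc _ ≤ ENNReal.ofReal (2 ^ n * c ^ N) * μ A + ENNReal.ofReal (2 ^ (n + 1) * c ^ N) * μ Aᶜ := by
          refine add_le_add ((setLIntegral_mono measurable_const hinA).trans ?_)
            ((lintegral_mono hout).trans ?_) <;> simp
      _ = ENNReal.ofReal (2 ^ n * c ^ N * μ.real A + 2 ^ (n + 1) * c ^ N * (1 - μ.real A)) := by
          rw [← ofReal_measureReal (μ := μ) (s := A), ← ofReal_measureReal (μ := μ) (s := Aᶜ),
            probReal_compl_eq_one_sub hAm, ← ENNReal.ofReal_mul (by positivity),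
            ← ENNReal.ofReal_mul (by positivity), ← ENNReal.ofReal_add (by positivity)]
          exact mul_nonneg (by positivity) (sub_nonneg.2 measureReal_le_one)
      _ ≤ _ := by
          refine ENNReal.ofReal_le_ofReal ?_
          have h1 : 2 ^ n * c ^ N * μ.real A + 2 ^ (n + 1) * c ^ N * (1 - μ.real A) =
            2 ^ (n + 1) * c ^ N * (1 - μ.real A / 2) := by ring
          rw [h1, pow_succ c, ← mul_assoc]
          gcongr
          linarith

end Sampling

/-! ### Null sets and submersions -/

/-- An injective linear map in finite dimension expands distances by at least some `1 / K`; near `x`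
the linearization error is at most half of that. -/
lemma HasStrictFDerivAt.exists_norm_sub_le {W G : Type*} [NormedAddCommGroup W] [NormedSpace ℝ W]
    [FiniteDimensional ℝ W] [NormedAddCommGroup G] [NormedSpace ℝ G] {g : W → G} {g' : W →L[ℝ] G}
    {x : W} (hg : HasStrictFDerivAt g g' x) (hinj : Function.Injective g') :
    ∃ C : NNReal, ∃ s ∈ 𝓝 x, ∀ y ∈ s, ∀ z ∈ s, dist y z ≤ C * dist (g y) (g z) := by
  obtain ⟨K, hK, hanti⟩ := g'.toLinearMap.exists_antilipschitzWith (LinearMap.ker_eq_bot.2 hinj)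
  obtain ⟨s, hs, happ⟩ := hg.approximates_deriv_on_nhds (c := (2 * K)⁻¹) (Or.inr (by positivity))
  refine ⟨2 * K, s, hs, fun y hy z hz => ?_⟩
  have h1 := happ y hy z hz
  have h2 : dist y z ≤ K * dist (g' y) (g' z) := hanti.le_mul_dist y z
  rw [dist_eq_norm, dist_eq_norm, ← map_sub] at h2
  have h3 : ‖g' (y - z)‖ ≤ ‖g y - g z - g' (y - z)‖ + ‖g y - g z‖ := by
    rw [norm_sub_rev (g y - g z)]
    have := norm_add_le (g' (y - z) - (g y - g z)) (g y - g z)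
    rwa [sub_add_cancel] at this
  have hK' : (0 : ℝ) < K := by exact_mod_cast hK
  have h4 : ‖y - z‖ ≤ K * ((2 * K : ℝ)⁻¹ * ‖y - z‖ + ‖g y - g z‖) := by
    refine h2.trans (mul_le_mul_of_nonneg_left ?_ hK'.le)
    push_cast at h1
    linarith
  have h5 : (K : ℝ) * ((2 * K : ℝ)⁻¹ * ‖y - z‖ + ‖g y - g z‖) =
      ‖y - z‖ / 2 + K * ‖g y - g z‖ := by
    field_simp
  rw [dist_eq_norm, dist_eq_norm]
  push_cast
  linarith

/-- Sets whose images under a coordinate system are contained in a null cylinder are null. -/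
lemma hausdorffMeasure_eq_zero_of_cylinder {W R N : Type*}
    [MetricSpace W] [MeasurableSpace W] [BorelSpace W] [Nonempty W]
    [NormedAddCommGroup R] [NormedSpace ℝ R] [FiniteDimensional ℝ R] [MeasurableSpace R]
    [BorelSpace R] [NormedAddCommGroup N] [NormedSpace ℝ N] [FiniteDimensional ℝ N]
    [MeasurableSpace N] [BorelSpace N] {Θ : W → R × N} {s : Set W} {C : NNReal}
    (hΘ : ∀ y ∈ s, ∀ z ∈ s, dist y z ≤ C * dist (Θ y) (Θ z)) {A : Set R}
    (hA : Measure.hausdorffMeasure (Module.finrank ℝ R : ℝ) A = 0) (hs : ∀ z ∈ s, (Θ z).1 ∈ A)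
    {d : ℕ} (hd : Module.finrank ℝ R + Module.finrank ℝ N = d) :
    Measure.hausdorffMeasure (d : ℝ) s = 0 := by
  have hRN : Measure.hausdorffMeasure (d : ℝ) (A ×ˢ (univ : Set N)) = 0 := by
    have h1 : (Measure.hausdorffMeasure (d : ℝ) : Measure (R × N)).IsAddHaarMeasure := by
      rw [← hd, ← Module.finrank_prod (R := ℝ)]
      exact isAddHaarMeasure_hausdorffMeasure
    have h2 : (Measure.hausdorffMeasure (Module.finrank ℝ R : ℝ) : Measure R).IsAddHaarMeasure :=
      isAddHaarMeasure_hausdorffMeasure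
    have h3 : (Measure.hausdorffMeasure (Module.finrank ℝ N : ℝ) : Measure N).IsAddHaarMeasure :=
      isAddHaarMeasure_hausdorffMeasure
    -- The Hausdorff measure of the product and the product of the Hausdorff measures are both Haar,
    -- hence have the same null sets.
    refine Measure.absolutelyContinuous_isAddHaarMeasure _
      ((Measure.hausdorffMeasure (Module.finrank ℝ R : ℝ) : Measure R).prod
        (Measure.hausdorffMeasure (Module.finrank ℝ N : ℝ) : Measure N)) ?_
    rw [Measure.prod_prod, hA, zero_mul]
  have hleft : ∀ z ∈ s, Function.invFunOn Θ s (Θ z) = z := fun z hz => by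
    have h1 : Θ (Function.invFunOn Θ s (Θ z)) = Θ z := Function.invFunOn_eq ⟨z, hz, rfl⟩
    have h2 := hΘ _ (Function.invFunOn_mem ⟨z, hz, rfl⟩ : Function.invFunOn Θ s (Θ z) ∈ s) z hz
    rw [h1, dist_self, mul_zero] at h2
    exact dist_le_zero.1 h2
  have hlip : LipschitzOnWith C (Function.invFunOn Θ s) (Θ '' s) := by
    refine LipschitzOnWith.of_dist_le_mul ?_
    rintro _ ⟨y, hy, rfl⟩ _ ⟨z, hz, rfl⟩
    rw [hleft y hy, hleft z hz]
    exact hΘ y hy z hz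
  have himg : Function.invFunOn Θ s '' (Θ '' s) = s := by
    rw [image_image]
    exact (image_congr hleft).trans (image_id s)
  rw [← himg]
  refine le_antisymm ((hlip.hausdorffMeasure_image_le (Nat.cast_nonneg d)).trans ?_) zero_le
  have hsub : Θ '' s ⊆ A ×ˢ (univ : Set N) := by
    rintro _ ⟨z, hz, rfl⟩
    exact ⟨hs z hz, mem_univ _⟩
  rw [measure_mono_null hsub hRN, mul_zero]

/-- A nonzero finite absolutely continuous measure has bounded density on a set of positive
measure. -/
lemma exists_measurableSet_le_smul {R : Type*} [MeasurableSpace R] (ν m : Measure R)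
    [IsFiniteMeasure ν] [SigmaFinite m] (hac : ν ≪ m) (h0 : ν ≠ 0) :
    ∃ (G : Set R) (M : ℕ), MeasurableSet G ∧ 0 < ν G ∧ ∀ B, MeasurableSet B →
      ν (G ∩ B) ≤ M * m B := by
  set g := ν.rnDeriv m with hg
  have hgm : Measurable g := Measure.measurable_rnDeriv ν m
  have hGm : ∀ M : ℕ, MeasurableSet {x | g x ≤ M} := fun M => measurableSet_le hgm measurable_const
  -- The density is finite almost everywhere, so its sublevel sets exhaust the mass.
  obtain ⟨M, hM⟩ : ∃ M : ℕ, 0 < ν {x | g x ≤ M} := by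
    by_contra! hcon
    refine h0 (Measure.measure_univ_eq_zero.1 ?_)
    have h1 : ν (⋃ M : ℕ, {x | g x ≤ M}) = 0 :=
      measure_iUnion_null fun M => le_antisymm (hcon M) zero_le
    have h2 : ∀ᵐ x ∂ν, g x < ⊤ := hac.ae_le (Measure.rnDeriv_lt_top ν m)
    have h3 : ∀ᵐ x ∂ν, x ∉ ⋃ M : ℕ, {x | g x ≤ M} := measure_eq_zero_iff_ae_notMem.1 h1
    have h4 : ∀ᵐ x ∂ν, False := by
      filter_upwards [h2, h3] with x hx hx'
      obtain ⟨M, hM⟩ := ENNReal.exists_nat_gt hx.ne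
      exact hx' (mem_iUnion.2 ⟨M, hM.le⟩)
    simpa [ae_iff] using h4
  refine ⟨_, M, hGm M, hM, fun B hB => ?_⟩
  have hν : ν = m.withDensity g := (Measure.withDensity_rnDeriv_eq ν m hac).symm
  calc ν ({x | g x ≤ M} ∩ B) = ∫⁻ x in {x | g x ≤ M} ∩ B, g x ∂m := by
        conv_lhs => rw [hν]
        exact withDensity_apply _ ((hGm M).inter hB)
    _ ≤ ∫⁻ _ in {x | g x ≤ M} ∩ B, (M : ENNReal) ∂m :=
        setLIntegral_mono measurable_const fun x hx => hx.1
    _ ≤ M * m B := by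
        rw [setLIntegral_const]
        gcongr
        exact inter_subset_right

/-! ### A patch of `Ω` on which `f` has `k`-dimensional image -/

/-- The local geometry used for the lower bound: a compact piece `K` of `Ω` with bounded paths, a
subset `K'` of positive measure, and a measurable `1`-Lipschitz image `Y` of `f` on `K'` whose
distribution has bounded density in dimension `k`. -/
lemma exists_patch {din dout d k : ℕ} {Ω : Set (EuclideanSpace ℝ (Fin din))}
    {f : EuclideanSpace ℝ (Fin din) → EuclideanSpace ℝ (Fin dout)} {x₀ : EuclideanSpace ℝ (Fin din)}
    (hx₀ : x₀ ∈ Ω) (hrank : HasJacobianRankAt d f Ω x₀ k)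
    (μ : Measure (EuclideanSpace ℝ (Fin din))) [IsProbabilityMeasure μ]
    (hμΩ : ∀ᵐ x ∂μ, x ∈ Ω) (hsupp : Ω ⊆ μ.support)
    (hμ : ∃ U ∈ 𝓝 x₀, μ.restrict U ≪ Measure.hausdorffMeasure (d : ℝ)) :
    ∃ (K K' : Set (EuclideanSpace ℝ (Fin din)))
      (R : Submodule ℝ (EuclideanSpace ℝ (Fin dout)))
      (Y : EuclideanSpace ℝ (Fin din) → R) (V D M : ℝ),
      K ⊆ Ω ∧ 0 < V ∧ HasBoundedPaths K V ∧ (∀ x ∈ K, ∀ y ∈ K, ‖x - y‖ ≤ D) ∧ K' ⊆ K ∧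
      MeasurableSet K' ∧ 0 < μ.real K' ∧ Measurable Y ∧
      (∀ x ∈ K', ∀ y ∈ K', dist (Y x) (Y y) ≤ ‖f x - f y‖) ∧ 0 ≤ M ∧
      ∀ y : R, ∀ r : ℝ, 0 < r → μ.real (K' ∩ {x | dist (Y x) y < r}) ≤ M * r ^ k := by
  classical
  obtain ⟨φ, hφ, hF, hk⟩ := hrank
  obtain ⟨U, hU, hμU⟩ := hμ
  set F' := fderiv ℝ (f ∘ φ) 0 with hF'
  set R := LinearMap.range F'.toLinearMap with hR
  set N := LinearMap.ker F'.toLinearMap with hN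
  set P := R.orthogonalProjectionOnto with hP
  set Q := N.orthogonalProjectionOnto with hQ
  have hFs : HasStrictFDerivAt (f ∘ φ) F' 0 := hF.hasStrictFDerivAt one_ne_zero
  have hφs : HasStrictFDerivAt φ (fderiv ℝ φ 0) 0 := hφ.contDiffAt.hasStrictFDerivAt one_ne_zero
  -- Coordinates adapted to `f ∘ φ`: the differential is seen by `P` on its range and its kernel by
  -- `Q`, so `Θ` has injective derivative at `0`.
  set Θ : EuclideanSpace ℝ (Fin d) → R × N := fun z => (P (f (φ z)), Q z) with hΘ
  have hΘs : HasStrictFDerivAt Θ ((P.comp F').prod Q) 0 :=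
    (P.hasStrictFDerivAt.comp 0 hFs).prodMk Q.hasStrictFDerivAt
  have hΘinj : Function.Injective ((P.comp F').prod Q) := by
    rw [injective_iff_map_eq_zero]
    intro v hv
    have hv1 : P (F' v) = 0 := congrArg Prod.fst hv
    have hv2 : Q v = 0 := congrArg Prod.snd hv
    have h1 : F' v = 0 := by
      have := Submodule.orthogonalProjectionOnto_mem_subspace_eq_self (K := R) ⟨F' v, ⟨v, rfl⟩⟩
      rw [← hP] at this
      simp only at this
      rw [hv1] at this
      exact (congrArg Subtype.val this).symm
    have := Submodule.orthogonalProjectionOnto_mem_subspace_eq_self (K := N) ⟨v, h1⟩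
    rw [← hQ] at this
    simp only at this
    rw [hv2] at this
    exact (congrArg Subtype.val this).symm
  obtain ⟨CΘ, s₁, hs₁, hΘa⟩ := hΘs.exists_norm_sub_le hΘinj
  obtain ⟨Cφ, s₂, hs₂, hφa⟩ := hφs.exists_norm_sub_le hφ.injective
  obtain ⟨Lφ, s₃, hs₃, hφl⟩ := hφs.exists_lipschitzOnWith
  obtain ⟨LF, s₄, hs₄, hFl⟩ := hFs.exists_lipschitzOnWith
  have hs₅ : φ ⁻¹' Ω ∈ 𝓝 (0 : EuclideanSpace ℝ (Fin d)) := by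
    rw [← Filter.mem_map, hφ.map_nhds]; exact self_mem_nhdsWithin
  have hs₆ : φ ⁻¹' U ∈ 𝓝 (0 : EuclideanSpace ℝ (Fin d)) :=
    hφ.contDiffAt.continuousAt (by rwa [hφ.map_zero])
  have hs₇ : {z | DifferentiableAt ℝ φ z} ∈ 𝓝 (0 : EuclideanSpace ℝ (Fin d)) := by
    filter_upwards [hφ.contDiffAt.eventually (by simp)] with z hz
    exact hz.differentiableAt one_ne_zero
  have hs₈ : {z | ‖fderiv ℝ φ z‖ < ‖fderiv ℝ φ 0‖ + 1} ∈ 𝓝 (0 : EuclideanSpace ℝ (Fin d)) :=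
    (hφ.contDiffAt.continuousAt_fderiv one_ne_zero).norm.eventually_lt_const (lt_add_one _)
  obtain ⟨ρ, hρ, hball⟩ := Metric.nhds_basis_closedBall.mem_iff.1
    (inter_mem hs₁ (inter_mem hs₂ (inter_mem hs₃ (inter_mem hs₄ (inter_mem hs₅ (inter_mem hs₆
      (inter_mem hs₇ hs₈)))))))
  set s : Set (EuclideanSpace ℝ (Fin d)) := Metric.closedBall 0 ρ with hs
  set K := φ '' s with hK
  have hsρ : ∀ z ∈ s, ∀ w ∈ s, ‖z - w‖ ≤ 2 * ρ := fun z hz w hw => by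
    rw [hs, mem_closedBall_zero_iff] at hz hw
    linarith [norm_sub_le z w]
  have hKc : IsCompact K := (isCompact_closedBall _ _).image_of_continuousOn
    (hφl.continuousOn.mono fun z hz => (hball hz).2.2.1)
  have hKΩ : K ⊆ Ω := by
    rintro _ ⟨z, hz, rfl⟩; exact (hball hz).2.2.2.2.1
  have hKU : K ⊆ U := by
    rintro _ ⟨z, hz, rfl⟩; exact (hball hz).2.2.2.2.2.1
  have hKnhds : K ∈ 𝓝[Ω] x₀ := by
    rw [← hφ.map_nhds]
    exact Filter.image_mem_map (Metric.closedBall_mem_nhds _ hρ)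
  have hμK : 0 < μ K := by
    obtain ⟨O, hO, hOK⟩ := mem_nhdsWithin_iff_exists_mem_nhds_inter.1 hKnhds
    refine ((Measure.mem_support_iff_forall x₀).1 (hsupp hx₀) O hO).trans_le (measure_mono_ae ?_)
    filter_upwards [hμΩ] with x hx hxO using hOK ⟨hxO, hx⟩
  -- `f` on `K` is the Lipschitz map `f ∘ φ` after the inverse of `φ`, which is Lipschitz as well.
  have hfK : ContinuousOn f K := by
    have : LipschitzOnWith (LF * Cφ) f K := by
      refine LipschitzOnWith.of_dist_le_mul ?_
      rintro _ ⟨z, hz, rfl⟩ _ ⟨w, hw, rfl⟩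
      have h1 := hFl.dist_le_mul z (hball hz).2.2.2.1 w (hball hw).2.2.2.1
      have h2 := hφa z (hball hz).2.1 w (hball hw).2.1
      calc dist (f (φ z)) (f (φ w)) ≤ LF * dist z w := h1
        _ ≤ LF * (Cφ * dist (φ z) (φ w)) := by gcongr
        _ = _ := by push_cast; ring
    exact this.continuousOn
  set Y : EuclideanSpace ℝ (Fin din) → R := K.piecewise (fun x => P (f x)) fun _ => 0 with hY
  have hYm : Measurable Y := ContinuousOn.measurable_piecewise
    (P.continuous.comp_continuousOn hfK) continuousOn_const hKc.measurableSet
  have hYK : ∀ x ∈ K, Y x = P (f x) := fun x hx => Set.piecewise_eq_of_mem _ _ _ hx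
  set m : Measure R := Measure.hausdorffMeasure (Module.finrank ℝ R : ℝ) with hm
  have hmH : m.IsAddHaarMeasure := isAddHaarMeasure_hausdorffMeasure
  -- The preimage of a null set is, in the coordinates `Θ`, part of a null cylinder; `φ` is
  -- Lipschitz and `μ` is absolutely continuous on `U ⊇ K`.
  have hac : (μ.restrict K).map Y ≪ m := by
    refine Measure.AbsolutelyContinuous.mk fun A hA hA0 => ?_
    rw [Measure.map_apply hYm hA, Measure.restrict_apply (hYm hA)]
    have h1 : Y ⁻¹' A ∩ K = φ '' {z ∈ s | (Θ z).1 ∈ A} := by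
      ext x
      constructor
      · rintro ⟨hxA, z, hz, rfl⟩
        refine ⟨z, ⟨hz, ?_⟩, rfl⟩
        rw [mem_preimage, hYK _ ⟨z, hz, rfl⟩] at hxA
        exact hxA
      · rintro ⟨z, ⟨hz, hzA⟩, rfl⟩
        refine ⟨?_, z, hz, rfl⟩
        rw [mem_preimage, hYK _ ⟨z, hz, rfl⟩]
        exact hzA
    have h2 : Measure.hausdorffMeasure (d : ℝ) {z ∈ s | (Θ z).1 ∈ A} = 0 := by
      refine hausdorffMeasure_eq_zero_of_cylinder (Θ := Θ) (C := CΘ)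
        (fun y hy z hz => hΘa y (hball hy.1).1 z (hball hz.1).1) hA0 (fun z hz => hz.2) ?_
      rw [LinearMap.finrank_range_add_finrank_ker, finrank_euclideanSpace_fin]
    have h3 : Measure.hausdorffMeasure (d : ℝ) (Y ⁻¹' A ∩ K) = 0 := by
      rw [h1]
      refine le_antisymm (((hφl.mono fun z hz => (hball hz.1).2.2.1).hausdorffMeasure_image_le
        (Nat.cast_nonneg d)).trans ?_) zero_le
      rw [h2, mul_zero]
    have h4 := hμU h3
    rwa [Measure.restrict_eq_self _ (inter_subset_right.trans hKU)] at h4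
  have hne : (μ.restrict K).map Y ≠ 0 := by
    intro h
    have := congrArg (fun ν : Measure R => ν univ) h
    simp only [Measure.map_apply hYm MeasurableSet.univ, preimage_univ, Measure.restrict_apply_univ,
      Measure.coe_zero, Pi.zero_apply] at this
    exact hμK.ne' this
  -- The density is bounded only over `G`, so the samples are taken from `K ∩ Y ⁻¹' G`; the curves
  -- may still run through all of `K`.
  obtain ⟨G, M, hG, hGpos, hGle⟩ := exists_measurableSet_le_smul _ m hac hne
  have hmap : ∀ B, MeasurableSet B → (μ.restrict K).map Y B = μ (K ∩ Y ⁻¹' B) := fun B hB => by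
    rw [Measure.map_apply hYm hB, Measure.restrict_apply (hYm hB), inter_comm]
  refine ⟨K, K ∩ Y ⁻¹' G, R, Y, (‖fderiv ℝ φ 0‖ + 1) * (2 * ρ), Lφ * (2 * ρ),
    (M * m (Metric.ball 0 1)).toReal, hKΩ, by positivity, ?_, ?_, inter_subset_left,
    hKc.measurableSet.inter (hYm hG), ?_, hYm, ?_, ENNReal.toReal_nonneg, ?_⟩
  · rintro _ ⟨z, hz, rfl⟩ _ ⟨w, hw, rfl⟩
    have hseg : ∀ t ∈ Icc (0 : ℝ) 1, z + t • (w - z) ∈ s := fun t ht =>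
      (convex_closedBall _ _).add_smul_sub_mem hz hw ht
    refine ⟨fun t => φ (z + t • (w - z)), fun t => fderiv ℝ φ (z + t • (w - z)) (w - z),
      by simp, by simp, fun t ht => ⟨?_, ?_, _, hseg t ht, rfl⟩⟩
    · have h1 : HasDerivAt (fun t : ℝ => z + t • (w - z)) (w - z) t := by
        simpa using ((hasDerivAt_id t).smul_const (w - z)).const_add z
      exact (hball (hseg t ht)).2.2.2.2.2.2.1.hasFDerivAt.comp_hasDerivAt t h1
    · refine (ContinuousLinearMap.le_opNorm _ _).trans ?_
      gcongr
      · exact (hball (hseg t ht)).2.2.2.2.2.2.2.le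
      · exact hsρ w hw z hz
  · rintro _ ⟨z, hz, rfl⟩ _ ⟨w, hw, rfl⟩
    have h1 := hφl.dist_le_mul z (hball hz).2.2.1 w (hball hw).2.2.1
    rw [dist_eq_norm, dist_eq_norm] at h1
    exact h1.trans (mul_le_mul_of_nonneg_left (hsρ z hz w hw) Lφ.coe_nonneg)
  · rw [hmap G hG] at hGpos
    exact ENNReal.toReal_pos hGpos.ne' (measure_ne_top _ _)
  · intro x hx y hy
    rw [hYK x hx.1, hYK y hy.1, dist_eq_norm, ← map_sub]
    exact Submodule.norm_orthogonalProjectionOnto_apply_le R _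
  · intro y r hr
    have hbm : MeasurableSet (Metric.ball y r) := Metric.isOpen_ball.measurableSet
    have h1 := hGle _ hbm
    rw [hmap _ (hG.inter hbm), Measure.addHaar_ball_of_pos m y hr, hk] at h1
    have h2 : K ∩ Y ⁻¹' G ∩ {x | dist (Y x) y < r} = K ∩ Y ⁻¹' (G ∩ Metric.ball y r) := by
      rw [preimage_inter, inter_assoc]; rfl
    rw [h2, measureReal_def]
    refine (ENNReal.toReal_mono ?_ h1).trans (le_of_eq ?_)
    · exact ENNReal.mul_ne_top (ENNReal.natCast_ne_top M)
        (ENNReal.mul_ne_top ENNReal.ofReal_ne_top measure_ball_lt_top.ne)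
    · rw [ENNReal.toReal_mul, ENNReal.toReal_mul, ENNReal.toReal_mul,
        ENNReal.toReal_ofReal (by positivity)]
      ring

/-! ### The main theorem -/

/-- The growth `2^n ≤ e^{qN/8}` is beaten by `(1 - q/4)^N ≤ e^{-qN/4}`. -/
lemma two_pow_mul_pow_le_exp {q : ℝ} (hq1 : q ≤ 1) {n N : ℕ} (hn : (n : ℝ) ≤ q / 8 * N) :
    2 ^ n * (1 - q / 4) ^ N ≤ Real.exp (-(q / 8) * N) := by
  have h1 : (2 : ℝ) ^ n ≤ Real.exp (q / 8 * N) := by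
    calc (2 : ℝ) ^ n ≤ Real.exp 1 ^ n := by
          gcongr; have := Real.add_one_le_exp (1 : ℝ); linarith
      _ = Real.exp n := by rw [← Real.exp_nat_mul, mul_one]
      _ ≤ _ := Real.exp_le_exp.2 hn
  have h2 : (1 - q / 4) ^ N ≤ Real.exp (-(q / 4) * N) := by
    calc (1 - q / 4) ^ N ≤ Real.exp (-(q / 4)) ^ N := by
          refine pow_le_pow_left₀ (by linarith) ?_ N
          have := Real.add_one_le_exp (-(q / 4)); linarith
      _ = _ := by rw [← Real.exp_nat_mul, mul_comm]
  calc _ ≤ Real.exp (q / 8 * N) * Real.exp (-(q / 4) * N) :=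
        mul_le_mul h1 h2 (pow_nonneg (by linarith) N) (Real.exp_pos _).le
    _ = _ := by rw [← Real.exp_add]; congr 1; ring

theorem theorem6 {din dout : ℕ} (a s : ℝ) (ha : a ∈ Set.Ioo (-1 : ℝ) 1) (hs : s ∈ Set.Icc a 1)
    (Ω : Set (EuclideanSpace ℝ (Fin din)))
    (f : EuclideanSpace ℝ (Fin din) → EuclideanSpace ℝ (Fin dout))
    (k d : ℕ) (hk : 1 < k) (x₀ : EuclideanSpace ℝ (Fin din)) (hx₀ : x₀ ∈ Ω)
    (hrank : HasJacobianRankAt d f Ω x₀ k)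
    (μ : Measure (EuclideanSpace ℝ (Fin din))) [IsProbabilityMeasure μ]
    (hμΩ : ∀ᵐ x ∂μ, x ∈ Ω) (hsupp : Ω ⊆ μ.support)
    (hμ : ∃ U ∈ 𝓝 x₀, μ.restrict U ≪ Measure.hausdorffMeasure (d : ℝ)) :
    ∃ c : ℝ, 0 < c ∧ ∃ L₀ : ℕ → ℝ → ℕ,
      Tendsto
        (fun N : ℕ => Measure.pi (fun _ : Fin N => μ)
          {X : Fin N → EuclideanSpace ℝ (Fin din) |
            ¬ ∀ (C : ℝ) (L : ℕ), L₀ N C ≤ L →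
              ∀ (θ : NetParams L din dout) (c₁ : ℝ), c₁ ≤ C →
                θ.normSq = (L : ℝ) + c₁ →
                bnRank (θ.out a) Ω = 1 →
                (∀ i, θ.out a (X i) = f (X i)) →
                ∃ x ∈ Ω, c * (L : ℝ) * Real.exp (-c₁) * (N : ℝ) ^ (4 - 4 / (k : ℝ)) ≤
                  (θ.ntk a s x x).trace})
        atTop (𝓝 0) := by
  have ha1 : |a| ≤ 1 := abs_le.2 ⟨ha.1.le, ha.2.le⟩
  have hs1 : |s| ≤ 1 := abs_le.2 ⟨ha.1.le.trans hs.1, hs.2⟩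
  obtain ⟨K, K', R, Y, V, D, M, hKΩ, hV, hpath, hD, hK'K, hK'm, hμK', hY, hYf, hM, hball⟩ :=
    exists_patch hx₀ hrank μ hμΩ hsupp hμ
  have hk0 : (k : ℝ) ≠ 0 := by exact_mod_cast (by omega : k ≠ 0)
  set q := μ.real K' with hq
  have hq1 : q ≤ 1 := measureReal_le_one
  -- Chosen so that `M * lam ^ k ≤ 1`: a ball of radius `r N` then has mass at most `1 / N`.
  set lam : ℝ := 1 / (M + 1) with hlam
  have hlam0 : 0 < lam := by positivity
  set r : ℕ → ℝ := fun N => lam * (N : ℝ) ^ (-(1 / (k : ℝ))) with hr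
  have hr0 : ∀ N : ℕ, 0 < N → 0 < r N := fun N hN =>
    mul_pos hlam0 (Real.rpow_pos_of_pos (by exact_mod_cast hN) _)
  set n : ℕ → ℕ := fun N => ⌊q / 8 * N⌋₊ with hn
  have hnle : ∀ N : ℕ, (n N : ℝ) ≤ q / 8 * N := fun N => Nat.floor_le (by positivity)
  -- The summands of `L₀` make the scalar coordinate accurate to `r N / 8`, give `C ≤ L`, and give
  -- `0 < L`.
  refine ⟨(q / 16 * lam) ^ 4 / (2 ^ 28 * V ^ 2), by positivity, fun N C =>
    ⌈2 * Real.exp (C + 1) * |C + 2 * Real.log (D / r N)| * D ^ 2 / (r N / 8) ^ 2⌉₊ + ⌈C⌉₊ + 1, ?_⟩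
  have hlim : Tendsto (fun N : ℕ => ENNReal.ofReal (Real.exp (-(q / 8) * N))) atTop (𝓝 0) := by
    rw [← ENNReal.ofReal_zero]
    refine ENNReal.tendsto_ofReal (Real.tendsto_exp_atBot.comp ?_)
    exact tendsto_natCast_atTop_atTop.const_mul_atTop_of_neg (by linarith)
  have hev : ∀ᶠ N : ℕ in atTop, 64 ≤ q / 8 * N := by
    exact (tendsto_natCast_atTop_atTop.const_mul_atTop (by positivity)).eventually_ge_atTop 64
  refine tendsto_of_tendsto_of_tendsto_of_le_of_le' tendsto_const_nhds hlim
    (Eventually.of_forall fun _ => zero_le) ?_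
  filter_upwards [hev] with N hN
  have hNpos : 0 < N := Nat.pos_of_ne_zero fun h => by rw [h] at hN; norm_num at hN
  have hNpos' : (0 : ℝ) < N := by exact_mod_cast hNpos
  have hn64 : 64 ≤ n N := Nat.le_floor (by exact_mod_cast hN)
  have hrk : r N ^ k = lam ^ k / N := by
    rw [hr, mul_pow, ← Real.rpow_natCast ((N : ℝ) ^ _) k, ← Real.rpow_mul hNpos'.le,
      neg_mul, one_div_mul_cancel hk0, Real.rpow_neg_one, div_eq_mul_inv]
  have hκ : ((∅ : Finset R).card + (n N : ℝ)) * (M * r N ^ k) ≤ q / 2 := by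
    have h1 : M * lam ^ k ≤ 1 := by
      have h2 : lam ≤ 1 := by rw [hlam, div_le_one (by positivity)]; linarith
      calc M * lam ^ k ≤ M * lam ^ 1 := by
            gcongr M * ?_; exact pow_le_pow_of_le_one hlam0.le h2 (by omega)
        _ ≤ 1 := by rw [pow_one, hlam, mul_one_div, div_le_one (by positivity)]; linarith
    calc _ = n N * (M * lam ^ k / N) := by
          rw [hrk, Finset.card_empty, Nat.cast_zero, zero_add, mul_div_assoc]
      _ ≤ (q / 8 * N) * (1 / N) := by gcongr; exact hnle N
      _ = q / 8 := by field_simp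
      _ ≤ q / 2 := by linarith
  have hprob := (measure_compl_separatedSamples_le μ hK'm hY
    (by have := hr0 N hNpos; positivity) (fun y => hball y (r N) (hr0 N hNpos)) N ∅ (n N) hκ).trans
    (ENNReal.ofReal_le_ofReal (two_pow_mul_pow_le_exp hq1 (hnle N)))
  refine (measure_mono ?_).trans hprob
  intro X hX hgood
  refine hX fun C L hL θ c₁ hc₁ hnorm _ hfit => ?_
  obtain ⟨S, hSn, hSK, hSsep⟩ := hgood
  have hrN := hr0 N hNpos
  have hL0 : 0 < L := by omega
  have hCL : C ≤ L := by
    have h1 : ⌈C⌉₊ ≤ L := by omega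
    exact (Nat.le_ceil C).trans (by exact_mod_cast h1)
  obtain ⟨x, hx, hxt⟩ := θ.exists_le_trace_ntk (s := s) ha1 hs1 hV hrN hpath hD hnorm hc₁ hCL hL0
    (by
      rw [mul_comm ((r N / 8) ^ 2), ← div_le_iff₀ (by positivity)]
      refine (Nat.le_ceil _).trans ?_
      exact_mod_cast (by omega :
        ⌈2 * Real.exp (C + 1) * |C + 2 * Real.log (D / r N)| * D ^ 2 / (r N / 8) ^ 2⌉₊ ≤ L))
    S (hn64.trans hSn) X (fun i hi => hK'K (hSK i hi).1) (fun i hi j hj hij => by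
      rw [hfit, hfit]
      exact (hSsep i hi j hj hij).trans (hYf _ (hSK i hi).1 _ (hSK j hj).1))
  refine ⟨x, hKΩ hx, le_trans ?_ hxt⟩
  -- Rounding down loses less than `1`, which is at most half of `q / 8 * N ≥ 64`.
  have hcard : q / 16 * N ≤ S.card := by
    have h1 := Nat.lt_floor_add_one (q / 8 * N)
    have h2 : (n N : ℝ) ≤ S.card := by exact_mod_cast hSn
    simp only [hn] at h2
    linarith
  have hpow : (q / 16 * lam) ^ 4 * (N : ℝ) ^ (4 - 4 / (k : ℝ)) = (q / 16 * N * r N) ^ 4 := by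
    have h1 : (N : ℝ) ^ (4 - 4 / (k : ℝ)) = (N : ℝ) ^ 4 * ((N : ℝ) ^ (-(1 / (k : ℝ)))) ^ 4 := by
      rw [← Real.rpow_natCast ((N : ℝ) ^ _) 4, ← Real.rpow_mul hNpos'.le,
        ← Real.rpow_natCast (N : ℝ) 4, ← Real.rpow_add hNpos']
      congr 1
      push_cast
      ring
    rw [h1, hr]; ring
  calc (q / 16 * lam) ^ 4 / (2 ^ 28 * V ^ 2) * L * Real.exp (-c₁) * (N : ℝ) ^ (4 - 4 / (k : ℝ))
      = L * Real.exp (-c₁) * ((q / 16 * lam) ^ 4 * (N : ℝ) ^ (4 - 4 / (k : ℝ))) /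
        (2 ^ 28 * V ^ 2) := by ring
    _ ≤ _ := by rw [hpow]; gcongr
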